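/- Let $(X_k,y_k)_{k=1}^n$, $n\ge 1$, be sequences $X_k=[x_1,\dots,x_T]$ of $T\ge 2$ tokens from a finite vocabulary $\mathcal S$ (every token of $\mathcal S$ occurs in some $X_k$) with labels $y_k\in\{-1,1\}$. A token is *completely positive* (*completely negative*) if it occurs only in sequences with label $1$ (label $-1$), and *irrelevant* if $\alpha_s:=\frac1{nT}\sum_k y_k\,\#\{i: (X_k)_i=s\}=0$. Assume that each $X_k$ consists of a single completely positive or completely negative token, denoted $s_*^{X_k}$, and $T-1$ irrelevant tokens. For $v\in\mathbb R^d$ with $\|v\|_2=1$, $p\in\mathbb R^d$ and $\boldsymbol E=(E_s)_{s\in\mathcal S}$, $E_s\in\mathbb R^d$, let $$f(X;p,\boldsymbol E)=\frac{\sum_{i=1}^T e^{p^\top E_{x_i}}E_{x_i}^\top v}{\sum_{j=1}^T e^{p^\top E_{x_j}}},\qquad \mathcal L(\boldsymbol E,p)=\frac1n\sum_{k=1}^n\log\bigl(1+e^{-y_kf(X_k;p,\boldsymbol E)}\bigr).$$ Let $E^0_s$ ($s\in\mathcal S$) and $p^0$ be i.i.d. $\mathcal N(0,\frac1d I)$,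 put $E_s=E^0_s-\eta_0\nabla_{E_s}\mathcal L(\boldsymbol E^0,p^0)$ and $p^1=p^0-\eta_0\nabla_p\mathcal L(\boldsymbol E^0,p^0)$, and let $p_t$, $t\ge0$, solve $\frac{d}{dt}p_t=-\nabla_p\mathcal L(\boldsymbol E,p_t)$ started at $p^1$, where $\boldsymbol E=(E_s)_s$ are the updated embeddings. For $p\in\mathbb R^d$ and $X\in\{X_1,\dots,X_n\}$ let $\mathcal S_X(p)=\operatorname{argmax}_{s\in X}p^\top E_s$ be the set of tokens selected by $p$. Two vectors have the same selection if they select the same tokens in every $X$. The max-margin solution of the selection made by $p_\circ$ is the minimizer of $\|p\|_2$ over all $p$ with the same selection as $p_\circ$ and $p^\top(E_s-E_{s'})\ge1$ for all $X$, all $s\in\mathcal S_X(p_\circ)$ and all $s'\in X\setminus\mathcal S_X(p_\circ)$. Let $\hat p$ be the minimizer of $\|p\|_2$ subject to $p^\top(E_{s_*^X}-E_s)\ge1$ for all $X$ and all $s\in X\setminus\{s_*^X\}$. Let $\delta>0$, $\mu>0$, $\eta_0\ge4n^2T^2$ and $$d\ge\max\Bigl\{256,\ \bigl(2\log\tfrac{|\mathcal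 S|^2}\delta\bigr)^2,\ (88\eta_0^2+111\eta_0+2)^8,\ |\mathcal S|+3,\ \Bigl(\tfrac{2816Tn^2(1+2\eta_0)}\mu\Bigr)^4,\ \Bigl(2\eta_0\bigl(n\sqrt{2\log\tfrac{|\mathcal S|^2}\delta}+44n\bigr)\Bigr)^4\Bigr\}.$$ Then there is an event of probability at least $1-\delta$ over $(\boldsymbol E^0,p^0)$ on which $\hat p$ exists and is unique and the following holds. Suppose that the limit $p_\infty:=\lim_{t\to\infty}p_t/\|p_t\|_2$ exists and that $\|\hat p\|_2<(1-\mu)\|\hat p'\|_2$ for every max-margin solution $\hat p'$ with a selection different from that of $\hat p$ and with direction $\hat p'/\|\hat p'\|_2=p_\infty$ (in particular, this is so if the inequality holds for every nonzero max-margin solution with a different selection). Then $p_\infty=\hat p/\|\hat p\|_2$, and $p_\infty$ selects no irrelevant token in any $X_k$. -/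

import Mathlib

open MeasureTheory ProbabilityTheory Filter Topology

namespace AttnSelect

noncomputable section

variable {S : Type*} {n T d : ℕ}

/-! ### Data -/

/-- Average signed frequency of the token `s` in the dataset `(X k, y k)`, `k : Fin n`. -/
def signedFreq [DecidableEq S] (X : Fin n → Fin T → S) (y : Fin n → ℝ) (s : S) : ℝ :=
  (∑ k, y k * ∑ i, if X k i = s then (1 : ℝ) else 0) / ((n : ℝ) * (T : ℝ))

/-- The token `s` is irrelevant: its average signed frequency vanishes. -/
def IsIrrelevant [DecidableEq S] (X : Fin n → Fin T → S) (y : Fin n → ℝ) (s : S) : Prop :=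
  signedFreq X y s = 0

/-- The token `s` appears only in sequences with label `1`. -/
def IsCompletelyPositive (X : Fin n → Fin T → S) (y : Fin n → ℝ) (s : S) : Prop :=
  ∀ k i, X k i = s → y k = 1

/-- The token `s` appears only in sequences with label `-1`. -/
def IsCompletelyNegative (X : Fin n → Fin T → S) (y : Fin n → ℝ) (s : S) : Prop :=
  ∀ k i, X k i = s → y k = -1

/-- The token `s` is completely positive or completely negative. -/
def IsImportant (X : Fin n → Fin T → S) (y : Fin n → ℝ) (s : S) : Prop :=
  IsCompletelyPositive X y s ∨ IsCompletelyNegative X y s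

/-- Among the `T` tokens of each sequence exactly one is completely positive or completely
negative, and all remaining ones are irrelevant. -/
def SingleImportantToken [DecidableEq S] (X : Fin n → Fin T → S) (y : Fin n → ℝ) : Prop :=
  ∀ k, ∃ i, IsImportant X y (X k i) ∧ ∀ j, j ≠ i → IsIrrelevant X y (X k j)

/-! ### Model, loss and training -/

/-- Output of the one-layer softmax attention model on the sequence `x`, with token embeddings
`E`, embedding `p` of the classification token, and output vector `v`. -/
def output (v : EuclideanSpace ℝ (Fin d)) (E : S → EuclideanSpace ℝ (Fin d))
    (p : EuclideanSpace ℝ (Fin d)) (x : Fin T → S) : ℝ :=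
  (∑ i, Real.exp (inner ℝ p (E (x i))) * inner ℝ (E (x i)) v) /
    ∑ j, Real.exp (inner ℝ p (E (x j)))

/-- Empirical logistic loss. -/
def loss (X : Fin n → Fin T → S) (y : Fin n → ℝ) (v : EuclideanSpace ℝ (Fin d))
    (E : S → EuclideanSpace ℝ (Fin d)) (p : EuclideanSpace ℝ (Fin d)) : ℝ :=
  (1 / (n : ℝ)) * ∑ k, Real.log (1 + Real.exp (-(y k * output v E p (X k))))

/-- Token embeddings after one gradient step of size `η` from `(E, p)`; the gradient is the
partial gradient in the embedding of `s`. -/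
def stepE [DecidableEq S] (X : Fin n → Fin T → S) (y : Fin n → ℝ)
    (v : EuclideanSpace ℝ (Fin d)) (η : ℝ)
    (E : S → EuclideanSpace ℝ (Fin d)) (p : EuclideanSpace ℝ (Fin d)) (s : S) :
    EuclideanSpace ℝ (Fin d) :=
  E s - η • gradient (fun e => loss X y v (Function.update E s e) p) (E s)

/-- Classification-token embedding after one gradient step of size `η` from `(E, p)`. -/
def stepP (X : Fin n → Fin T → S) (y : Fin n → ℝ) (v : EuclideanSpace ℝ (Fin d)) (η : ℝ)
    (E : S → EuclideanSpace ℝ (Fin d)) (p : EuclideanSpace ℝ (Fin d)) :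
    EuclideanSpace ℝ (Fin d) :=
  p - η • gradient (fun q => loss X y v E q) p

/-- `p t`, `t ≥ 0`, is the gradient flow of the loss in the classification-token embedding,
with fixed token embeddings `E`, started at `pInit`. -/
def IsGradientFlow (X : Fin n → Fin T → S) (y : Fin n → ℝ) (v : EuclideanSpace ℝ (Fin d))
    (E : S → EuclideanSpace ℝ (Fin d)) (pInit : EuclideanSpace ℝ (Fin d))
    (p : ℝ → EuclideanSpace ℝ (Fin d)) : Prop :=
  p 0 = pInit ∧ ∀ t, 0 ≤ t →
    HasDerivWithinAt p (-gradient (fun q => loss X y v E q) (p t)) (Set.Ici 0) t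

/-! ### Token selection and max-margin problems -/

/-- The tokens of the sequence `x` selected by `p`. -/
def selected (E : S → EuclideanSpace ℝ (Fin d)) (p : EuclideanSpace ℝ (Fin d))
    (x : Fin T → S) : Set S :=
  {s | s ∈ Set.range x ∧ ∀ s' ∈ Set.range x, inner ℝ p (E s') ≤ inner ℝ p (E s)}

/-- `p` and `p'` select the same tokens in every sequence of the dataset. -/
def SameSelection (X : Fin n → Fin T → S) (E : S → EuclideanSpace ℝ (Fin d))
    (p p' : EuclideanSpace ℝ (Fin d)) : Prop :=
  ∀ k, selected E p (X k) = selected E p' (X k)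

/-- Feasible set of the max-margin problem of the selection made by `p₀`. -/
def marginSet (X : Fin n → Fin T → S) (E : S → EuclideanSpace ℝ (Fin d))
    (p₀ : EuclideanSpace ℝ (Fin d)) : Set (EuclideanSpace ℝ (Fin d)) :=
  {p | SameSelection X E p p₀ ∧
    ∀ k, ∀ s ∈ selected E p₀ (X k), ∀ s' ∈ Set.range (X k) \ selected E p₀ (X k),
      1 ≤ inner ℝ p (E s - E s')}

/-- `q` solves the max-margin problem of the selection made by `p₀`. -/
def IsMaxMargin (X : Fin n → Fin T → S) (E : S → EuclideanSpace ℝ (Fin d))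
    (p₀ q : EuclideanSpace ℝ (Fin d)) : Prop :=
  q ∈ marginSet X E p₀ ∧ ∀ p ∈ marginSet X E p₀, ‖q‖ ≤ ‖p‖

/-- Feasible set of the max-margin problem that selects, in every sequence, only the completely
positive/negative token. -/
def importantMarginSet (X : Fin n → Fin T → S) (y : Fin n → ℝ)
    (E : S → EuclideanSpace ℝ (Fin d)) : Set (EuclideanSpace ℝ (Fin d)) :=
  {p | ∀ k, ∀ s ∈ Set.range (X k), IsImportant X y s → ∀ s' ∈ Set.range (X k) \ {s},
      1 ≤ inner ℝ p (E s - E s')}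

/-- `q` solves the max-margin problem that selects only the completely positive/negative
tokens. -/
def IsImportantMaxMargin (X : Fin n → Fin T → S) (y : Fin n → ℝ)
    (E : S → EuclideanSpace ℝ (Fin d)) (q : EuclideanSpace ℝ (Fin d)) : Prop :=
  q ∈ importantMarginSet X y E ∧ ∀ p ∈ importantMarginSet X y E, ‖q‖ ≤ ‖p‖

/-! ### Random initialization -/

/-- The Gaussian law `N(0, I/d)` on `ℝ^d`. -/
def gaussianVec (d : ℕ) : Measure (EuclideanSpace ℝ (Fin d)) :=
  (Measure.pi fun _ : Fin d => gaussianReal 0 ((d : NNReal)⁻¹)).map (WithLp.toLp 2)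

/-- Joint law of the initial embeddings `(E⁰, p⁰)`: all vectors independent with law
`N(0, I/d)`. -/
def initLaw (S : Type*) [Fintype S] (d : ℕ) :
    Measure ((S → EuclideanSpace ℝ (Fin d)) × EuclideanSpace ℝ (Fin d)) :=
  (Measure.pi fun _ : S => gaussianVec d).prod (gaussianVec d)

end

end AttnSelect

-- The good event is that the initial vectors have squared norms in a fixed range and pairwise inner
-- products, as well as components along `v`, at most `τ = 3 / d^(1/4)`. Gaussian tails and a union
-- bound give it probability at least `1 - δ`. The rest is deterministic on that event.
--
-- At initialization the attention is nearly uniform and every logistic residual is nearly `1/2`, so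
-- the embedding step adds about `η α_s / 2` times `v` to the embedding of `s`. Irrelevant tokens
-- therefore keep a value close to `0`, while the important token of each sequence acquires signed
-- value at least about `2nT`. Attention is still nearly uniform after the step, so every margin is
-- at least `n` and `n` times the loss is at most `n e^(-n) ≤ e^(-1)`
-- (`NearOrthogonal.loss_step_le`). Near-orthogonality also makes the max-margin problem for the
-- important tokens feasible (`NearOrthogonal.exists_separator`).
--
-- The flow decreases the loss, so all margins stay at least `1/2`. This keeps the attention on each
-- important token away from zero. The velocity is then a positive combination of the differences
-- `z` between important and other embeddings, with weights comparable to `exp (-⟪p, z⟫)`. For such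
-- a flow the direction with the worst margin dominates, as for gradient descent on separable
-- logistic data: a limit direction `w` with smallest margin `m₀` satisfies `1 ≤ m₀ ⟪w, u⟫` for
-- every feasible `u` (`margin_of_exp_flow`). Taking for `u` the max-margin solution `q`, `m₀⁻¹ w`
-- is feasible with norm at most `‖q‖`. By uniqueness of the minimizer it is `q`, and `m₀ > 0` says
-- that `w` selects only important tokens.

namespace AttnSelect

/-! ### Gradient calculus for softmax averages and the logistic loss -/

section Calculus

variable {F : Type*} [NormedAddCommGroup F] [InnerProductSpace ℝ F] [CompleteSpace F]

theorem hasGradientAt_inner_left (e x : F) : HasGradientAt (fun q : F => inner ℝ q e) e x := by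
  rw [hasGradientAt_iff_hasFDerivAt]
  have h : (fun q : F => inner ℝ q e) = fun q => (InnerProductSpace.toDual ℝ F e) q := by
    funext q
    rw [InnerProductSpace.toDual_apply_apply, real_inner_comm]
  rw [h]
  exact ContinuousLinearMap.hasFDerivAt _

theorem hasGradientAt_inner_right (e x : F) : HasGradientAt (fun q : F => inner ℝ e q) e x := by
  simpa only [real_inner_comm] using hasGradientAt_inner_left e x

theorem hasGradientAt_comp {f : F → ℝ} {f' x : F} {φ : ℝ → ℝ} {φ' : ℝ}
    (hφ : HasDerivAt φ φ' (f x)) (hf : HasGradientAt f f' x) :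
    HasGradientAt (fun q => φ (f q)) (φ' • f') x := by
  rw [hasGradientAt_iff_hasFDerivAt] at hf ⊢
  have := hφ.comp_hasFDerivAt x hf
  rw [map_smul]
  exact this

theorem hasGradientAt_sum {ι : Type*} [Fintype ι] {f : ι → F → ℝ} {f' : ι → F} {x : F}
    (hf : ∀ i, HasGradientAt (f i) (f' i) x) :
    HasGradientAt (fun q => ∑ i, f i q) (∑ i, f' i) x := by
  simp only [hasGradientAt_iff_hasFDerivAt, map_sum] at hf ⊢
  exact HasFDerivAt.fun_sum fun i _ => hf i

theorem hasGradientAt_mul {f g : F → ℝ} {f' g' x : F}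
    (hf : HasGradientAt f f' x) (hg : HasGradientAt g g' x) :
    HasGradientAt (fun q => f q * g q) (f x • g' + g x • f') x := by
  simp only [hasGradientAt_iff_hasFDerivAt, map_add, map_smul] at hf hg ⊢
  exact hf.mul hg

/-- Gradient of a softmax average of the values `γ i` with scores `a i`. -/
theorem hasGradientAt_softmaxAverage {ι : Type*} [Fintype ι] [Nonempty ι] {a γ : ι → F → ℝ}
    {a' γ' : ι → F} {x : F} (ha : ∀ i, HasGradientAt (a i) (a' i) x)
    (hγ : ∀ i, HasGradientAt (γ i) (γ' i) x) :
    HasGradientAt (fun q => (∑ i, Real.exp (a i q) * γ i q) / ∑ j, Real.exp (a j q))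
      (∑ i, (Real.exp (a i x) / ∑ j, Real.exp (a j x)) •
        (γ' i + (γ i x - (∑ i, Real.exp (a i x) * γ i x) / ∑ j, Real.exp (a j x)) • a' i)) x := by
  have hZ : 0 < ∑ j, Real.exp (a j x) :=
    Finset.sum_pos (fun _ _ => Real.exp_pos _) Finset.univ_nonempty
  have hexp : ∀ i, HasGradientAt (fun q => Real.exp (a i q)) (Real.exp (a i x) • a' i) x :=
    fun i => hasGradientAt_comp (Real.hasDerivAt_exp _) (ha i)
  have hN := hasGradientAt_sum fun i => hasGradientAt_mul (hexp i) (hγ i)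
  have hD := hasGradientAt_comp (φ := fun r => r⁻¹) (hasDerivAt_inv hZ.ne')
    (f := fun q => ∑ j, Real.exp (a j q)) (hasGradientAt_sum hexp)
  have h := hasGradientAt_mul hN hD
  simp only [div_eq_mul_inv]
  convert h using 1
  set Z := ∑ j, Real.exp (a j x)
  set N := ∑ i, Real.exp (a i x) * γ i x
  rw [Finset.smul_sum, Finset.smul_sum, Finset.smul_sum, ← Finset.sum_add_distrib]
  refine Finset.sum_congr rfl fun i _ => ?_
  rw [← inv_pow]
  module

theorem hasDerivAt_logistic (y r : ℝ) :
    HasDerivAt (fun r => Real.log (1 + Real.exp (-(y * r))))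
      (-(y * (1 + Real.exp (y * r))⁻¹)) r := by
  have h1 : HasDerivAt (fun r : ℝ => 1 + Real.exp (-(y * r))) (Real.exp (-(y * r)) * -(y * 1)) r :=
    (((hasDerivAt_id r).const_mul y).neg.exp).const_add 1
  have hp : (0 : ℝ) < 1 + Real.exp (-(y * r)) := by positivity
  convert h1.log hp.ne' using 1
  rw [Real.exp_neg]
  have := Real.exp_pos (y * r)
  field_simp
  ring

end Calculus

/-! ### Attention weights, residuals and gradients of the loss -/

section Model

variable {S : Type*} {n T d : ℕ}

/-- Attention weight of the `i`-th token of the sequence `x`. -/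
noncomputable def weight (E : S → EuclideanSpace ℝ (Fin d)) (p : EuclideanSpace ℝ (Fin d))
    (x : Fin T → S) (i : Fin T) : ℝ :=
  Real.exp (inner ℝ p (E (x i))) / ∑ j, Real.exp (inner ℝ p (E (x j)))

/-- Negative derivative of the logistic loss of the sequence `k` in its signed margin. -/
noncomputable def residual (X : Fin n → Fin T → S) (y : Fin n → ℝ) (v : EuclideanSpace ℝ (Fin d))
    (E : S → EuclideanSpace ℝ (Fin d)) (p : EuclideanSpace ℝ (Fin d)) (k : Fin n) : ℝ :=
  (1 + Real.exp (y k * output v E p (X k)))⁻¹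

variable (X : Fin n → Fin T → S) (y : Fin n → ℝ) (v : EuclideanSpace ℝ (Fin d))
    (E : S → EuclideanSpace ℝ (Fin d)) (p : EuclideanSpace ℝ (Fin d))

theorem residual_pos (k : Fin n) : 0 < residual X y v E p k := by
  unfold residual; positivity

theorem residual_le_one (k : Fin n) : residual X y v E p k ≤ 1 := by
  unfold residual
  apply inv_le_one_of_one_le₀
  have := Real.exp_pos (y k * output v E p (X k))
  linarith

theorem weight_nonneg (x : Fin T → S) (i : Fin T) : 0 ≤ weight E p x i := by
  unfold weight; positivity

theorem sum_exp_pos (x : Fin T → S) (i : Fin T) : 0 < ∑ j, Real.exp (inner ℝ p (E (x j))) :=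
  Finset.sum_pos (fun _ _ => Real.exp_pos _) ⟨i, Finset.mem_univ i⟩

theorem weight_pos (x : Fin T → S) (i : Fin T) : 0 < weight E p x i :=
  div_pos (Real.exp_pos _) (sum_exp_pos E p x i)

theorem sum_weight (hT : 0 < T) (x : Fin T → S) : ∑ i, weight E p x i = 1 := by
  unfold weight
  rw [← Finset.sum_div, div_self (sum_exp_pos E p x ⟨0, hT⟩).ne']

theorem weight_le_one (x : Fin T → S) (i : Fin T) : weight E p x i ≤ 1 := by
  rw [← sum_weight E p (i.pos) x]
  exact Finset.single_le_sum (fun j _ => weight_nonneg E p x j) (Finset.mem_univ i)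

theorem output_eq (x : Fin T → S) :
    output v E p x = ∑ i, weight E p x i * inner ℝ (E (x i)) v := by
  unfold output weight
  rw [Finset.sum_div]
  exact Finset.sum_congr rfl fun i _ => by ring

variable {X y v E p}

theorem hasGradientAt_loss {f : Fin n → EuclideanSpace ℝ (Fin d) → ℝ}
    {f' : Fin n → EuclideanSpace ℝ (Fin d)} {x : EuclideanSpace ℝ (Fin d)}
    (hf : ∀ k, HasGradientAt (f k) (f' k) x) :
    HasGradientAt (fun q => (1 / (n : ℝ)) * ∑ k, Real.log (1 + Real.exp (-(y k * f k q))))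
      (-((1 / (n : ℝ)) • ∑ k, (y k * (1 + Real.exp (y k * f k x))⁻¹) • f' k)) x := by
  have h := hasGradientAt_sum fun k =>
    hasGradientAt_comp (hasDerivAt_logistic (y k) (f k x)) (hf k)
  have h2 := hasGradientAt_comp
    (φ := fun r => (1 / (n : ℝ)) * r) ((hasDerivAt_id _).const_mul (1 / (n : ℝ))) h
  convert h2 using 1
  simp [neg_smul, Finset.sum_neg_distrib]

/-- Gradient of the loss in the classification-token embedding. -/
theorem hasGradientAt_loss_classification (hT : 0 < T) :
    HasGradientAt (fun q => loss X y v E q)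
      (-((1 / (n : ℝ)) • ∑ k, (y k * residual X y v E p k) •
        ∑ i, (weight E p (X k) i * (inner ℝ (E (X k i)) v - output v E p (X k))) • E (X k i))) p := by
  have : Nonempty (Fin T) := ⟨⟨0, hT⟩⟩
  have h := hasGradientAt_loss (y := y) fun k => hasGradientAt_softmaxAverage
    (fun i => hasGradientAt_inner_left (E (X k i)) p)
    (γ := fun i _ => inner ℝ (E (X k i)) v) (γ' := fun _ => 0)
    (fun i => by
      rw [hasGradientAt_iff_hasFDerivAt, map_zero]; exact hasFDerivAt_const _ _)
  simp only [zero_add, smul_smul] at h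
  exact h

/-- Gradient of the loss in the embedding of the token `s`. -/
theorem hasGradientAt_loss_token [DecidableEq S] (hT : 0 < T) (s : S) :
    HasGradientAt (fun e => loss X y v (Function.update E s e) p)
      (-((1 / (n : ℝ)) • ∑ k, (y k * residual X y v E p k) •
        ∑ i, if X k i = s then weight E p (X k) i •
          (v + (inner ℝ (E s) v - output v E p (X k)) • p) else 0)) (E s) := by
  have : Nonempty (Fin T) := ⟨⟨0, hT⟩⟩
  have h := hasGradientAt_loss (y := y) (x := E s) fun k => hasGradientAt_softmaxAverage
    (a := fun i e => inner ℝ p (Function.update E s e (X k i)))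
    (a' := fun i => if X k i = s then p else 0)
    (γ := fun i e => inner ℝ (Function.update E s e (X k i)) v)
    (γ' := fun i => if X k i = s then v else 0) (x := E s)
    (fun i => by
      by_cases hi : X k i = s
      · simp only [hi, Function.update_self, if_true]
        exact hasGradientAt_inner_right _ _
      · simp only [hi, Function.update_of_ne, if_false, ne_eq, not_false_eq_true]
        rw [hasGradientAt_iff_hasFDerivAt, map_zero]; exact hasFDerivAt_const _ _)
    (fun i => by
      by_cases hi : X k i = s
      · simp only [hi, Function.update_self, if_true]
        exact hasGradientAt_inner_left _ _
      · simp only [hi, Function.update_of_ne, if_false, ne_eq, not_false_eq_true]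
        rw [hasGradientAt_iff_hasFDerivAt, map_zero]; exact hasFDerivAt_const _ _)
  simp only [Function.update_eq_self] at h
  have hterm : ∀ k i, (if X k i = s then weight E p (X k) i •
      (v + (inner ℝ (E s) v - output v E p (X k)) • p) else 0) =
      weight E p (X k) i • ((if X k i = s then v else 0) +
        (inner ℝ (E (X k i)) v - output v E p (X k)) • if X k i = s then p else 0) := by
    intro k i
    by_cases hi : X k i = s
    · simp only [hi, if_true]
    · simp [hi]
  simp only [hterm]
  exact h

end Model

/-! ### Flows with exponentially decaying weights on separable data -/

section AbstractFlow

theorem mul_sub_le_of_deriv_ge {φ φ' : ℝ → ℝ} {a κ : ℝ} (ha : 0 ≤ a)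
    (hφ : ∀ t, 0 ≤ t → HasDerivWithinAt φ (φ' t) (Set.Ici 0) t) (hκ : ∀ t, a ≤ t → κ ≤ φ' t)
    {t : ℝ} (hat : a ≤ t) : κ * (t - a) ≤ φ t - φ a := by
  have hd : ∀ t, 0 < t → HasDerivAt φ (φ' t) t := fun t ht =>
    (hφ t ht.le).hasDerivAt (Ici_mem_nhds ht)
  refine Convex.mul_sub_le_image_sub_of_le_deriv (convex_Ici a) ?_ ?_ ?_ a Set.self_mem_Ici t hat
    hat
  · exact fun s hs => (hφ s (ha.trans hs)).continuousWithinAt.mono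
      (Set.Ici_subset_Ici.2 ha)
  · intro s hs
    rw [interior_Ici] at hs
    exact (hd s (ha.trans_lt hs)).differentiableAt.differentiableWithinAt
  · intro s hs
    rw [interior_Ici] at hs
    rw [(hd s (ha.trans_lt hs)).deriv]
    exact hκ s (le_of_lt hs)

variable {F : Type*} [NormedAddCommGroup F] [InnerProductSpace ℝ F]
  {ι : Type*} {I : Finset ι} {z : ι → F} {c : ι → ℝ → ℝ} {p : ℝ → F} {b₁ b₂ : ℝ} {u : F}

theorem hasDerivWithinAt_inner_const {p' : F} {t : ℝ} {s : Set ℝ} (w : F)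
    (h : HasDerivWithinAt p p' s t) :
    HasDerivWithinAt (fun t => inner ℝ (p t) w) (inner ℝ p' w) s t := by
  simpa using h.inner ℝ (hasDerivWithinAt_const t s w)

/-- A positive combination flow with exponentially decaying weights leaves every bounded set,
provided the data are separable. -/
theorem tendsto_inner_atTop_of_exp_flow (hI : I.Nonempty)
    (hp : ∀ t, 0 ≤ t → HasDerivWithinAt p (∑ m ∈ I, c m t • z m) (Set.Ici 0) t)
    (hb₁ : 0 < b₁)
    (hc₁ : ∀ t, 0 ≤ t → ∀ m ∈ I, b₁ * Real.exp (-inner ℝ (p t) (z m)) ≤ c m t)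
    (hu : ∀ m ∈ I, 1 ≤ inner ℝ u (z m)) :
    Tendsto (fun t => inner ℝ (p t) u) atTop atTop := by
  obtain ⟨Z, hZ⟩ : ∃ Z : ℝ, ∀ m ∈ I, ‖z m‖ ≤ Z := by
    obtain ⟨Z, hZ⟩ := (I.image fun m => ‖z m‖).bddAbove
    exact ⟨Z, fun m hm => hZ (by simpa using ⟨m, hm, rfl⟩)⟩
  obtain ⟨m₁, hm₁⟩ := hI
  have hZ0 : 0 ≤ Z := (norm_nonneg _).trans (hZ m₁ hm₁)
  have hcpos : ∀ t, 0 ≤ t → ∀ m ∈ I, 0 ≤ c m t := fun t ht m hm =>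
    (mul_nonneg hb₁.le (Real.exp_pos _).le).trans (hc₁ t ht m hm)
  set h : ℝ → ℝ := fun t => inner ℝ (p t) u with hh
  set h' : ℝ → ℝ := fun t => inner ℝ (∑ m ∈ I, c m t • z m) u with hh'
  have hder : ∀ t, 0 ≤ t → HasDerivWithinAt h (h' t) (Set.Ici 0) t := fun t ht =>
    hasDerivWithinAt_inner_const u (hp t ht)
  have hsum : ∀ t, 0 ≤ t → ∑ m ∈ I, c m t ≤ h' t := fun t ht => by
    simp only [hh', sum_inner, real_inner_smul_left]
    refine Finset.sum_le_sum fun m hm => ?_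
    have := hu m hm
    rw [real_inner_comm]
    nlinarith [hcpos t ht m hm]
  have hsum0 : ∀ t, 0 ≤ t → 0 ≤ ∑ m ∈ I, c m t := fun t ht =>
    Finset.sum_nonneg (hcpos t ht)
  have hmono : ∀ a t, 0 ≤ a → a ≤ t → h a ≤ h t := fun a t ha hat => by
    have := mul_sub_le_of_deriv_ge ha hder (κ := 0)
      (fun s hs => (hsum0 s (ha.trans hs)).trans (hsum s (ha.trans hs))) hat
    linarith
  -- The speed is at most `Z ∑ c m ≤ Z h'`, so the length of the path is controlled by the growth of
  -- `h = ⟪p, u⟫`.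
  have hnorm : ∀ t, 0 ≤ t → ‖p t‖ ≤ ‖p 0‖ + Z * (h t - h 0) := fun t ht => by
    refine image_norm_le_of_norm_deriv_right_le_deriv_boundary' (f := p) (a := 0) (b := t)
      (f' := fun t => ∑ m ∈ I, c m t • z m)
      (B := fun t => ‖p 0‖ + Z * (h t - h 0)) (B' := fun t => Z * h' t) ?_ ?_ ?_ ?_ ?_ ?_
      (Set.right_mem_Icc.2 ht)
    · exact fun s hs => (hp s hs.1).continuousWithinAt.mono Set.Icc_subset_Ici_self
    · exact fun s hs => (hp s hs.1).mono (Set.Ici_subset_Ici.2 hs.1)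
    · simp
    · intro s hs
      have := (hder s hs.1).continuousWithinAt.mono (Set.Icc_subset_Ici_self : Set.Icc 0 t ⊆ Set.Ici 0)
      exact (continuousWithinAt_const.add (continuousWithinAt_const.mul
        (this.sub continuousWithinAt_const)))
    · intro s hs
      have := (hder s hs.1).mono (Set.Ici_subset_Ici.2 hs.1)
      exact ((this.sub_const _).const_mul Z).const_add _
    · intro s hs
      calc ‖∑ m ∈ I, c m s • z m‖ ≤ ∑ m ∈ I, ‖c m s • z m‖ := norm_sum_le _ _
        _ ≤ ∑ m ∈ I, Z * c m s := Finset.sum_le_sum fun m hm => by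
            rw [norm_smul, Real.norm_of_nonneg (hcpos s hs.1 m hm), mul_comm]
            exact mul_le_mul_of_nonneg_right (hZ m hm) (hcpos s hs.1 m hm)
        _ = Z * ∑ m ∈ I, c m s := by rw [Finset.mul_sum]
        _ ≤ Z * h' s := mul_le_mul_of_nonneg_left (hsum s hs.1) hZ0
  -- If `h` were bounded, so would be `p`; the weight of `m₁` would then stay above some `κ > 0` and
  -- `h` would grow linearly.
  have hunb : ∀ H : ℝ, ∃ t, 0 ≤ t ∧ H < h t := by
    intro H
    by_contra! hH
    set R := ‖p 0‖ + Z * (H - h 0)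
    have hR : ∀ t, 0 ≤ t → ‖p t‖ ≤ R := fun t ht =>
      (hnorm t ht).trans (by simp only [R]; gcongr; exact hH t ht)
    set κ := b₁ * Real.exp (-(R * Z))
    have hκ : 0 < κ := by positivity
    have hlow : ∀ t, 0 ≤ t → κ ≤ h' t := fun t ht => by
      refine le_trans ?_ (hsum t ht)
      refine le_trans ?_ (Finset.single_le_sum (hcpos t ht) hm₁)
      refine le_trans ?_ (hc₁ t ht m₁ hm₁)
      simp only [κ]
      gcongr
      exact (real_inner_le_norm _ _).trans
        (mul_le_mul (hR t ht) (hZ m₁ hm₁) (norm_nonneg _) ((norm_nonneg _).trans (hR t ht)))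
    have h1 := mul_sub_le_of_deriv_ge le_rfl hder hlow
      (t := (|H - h 0| + 1) / κ) (by positivity)
    have h2 := hH ((|H - h 0| + 1) / κ) (by positivity)
    rw [sub_zero, mul_div_cancel₀ _ hκ.ne'] at h1
    have := le_abs_self (H - h 0)
    linarith
  rw [tendsto_atTop]
  intro H
  obtain ⟨t₀, ht₀, hHt⟩ := hunb H
  filter_upwards [eventually_ge_atTop t₀] with t ht
  exact hHt.le.trans (hmono t₀ t ht₀ ht)

/-- The direction of a positive combination flow with exponentially decaying weights has optimal
margin. -/
theorem margin_of_exp_flow (hI : I.Nonempty)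
    (hp : ∀ t, 0 ≤ t → HasDerivWithinAt p (∑ m ∈ I, c m t • z m) (Set.Ici 0) t)
    (hb₁ : 0 < b₁)
    (hc₁ : ∀ t, 0 ≤ t → ∀ m ∈ I, b₁ * Real.exp (-inner ℝ (p t) (z m)) ≤ c m t)
    (hc₂ : ∀ t, 0 ≤ t → ∀ m ∈ I, c m t ≤ b₂ * Real.exp (-inner ℝ (p t) (z m)))
    {K : ℝ} (hK : ∀ t, 0 ≤ t → ∀ m ∈ I, -K ≤ inner ℝ (p t) (z m))
    (hu : ∀ m ∈ I, 1 ≤ inner ℝ u (z m))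
    {w : F} (hw : Tendsto (fun t => ‖p t‖⁻¹ • p t) atTop (𝓝 w)) :
    ‖w‖ = 1 ∧ ∃ m₀ : ℝ, (∀ m ∈ I, m₀ ≤ inner ℝ w (z m)) ∧ 0 < m₀ ∧ 1 ≤ m₀ * inner ℝ w u := by
  have hpu := tendsto_inner_atTop_of_exp_flow hI hp hb₁ hc₁ hu
  have hnorm : Tendsto (fun t => ‖p t‖) atTop atTop := by
    have hu0 : 0 < ‖u‖ := by
      obtain ⟨m, hm⟩ := hI
      rw [norm_pos_iff]
      rintro rfl
      have := hu m hm
      simp at this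
      linarith
    have h1 : Tendsto (fun t => inner ℝ (p t) u / ‖u‖) atTop atTop :=
      hpu.atTop_div_const hu0
    refine tendsto_atTop_mono (fun t => ?_) h1
    rw [div_le_iff₀ hu0]
    exact real_inner_le_norm _ _
  have hpos : ∀ᶠ t in atTop, 0 < ‖p t‖ := hnorm.eventually_gt_atTop 0
  have hinner : ∀ x : F, Tendsto (fun t => ‖p t‖⁻¹ * inner ℝ (p t) x) atTop (𝓝 (inner ℝ w x)) := by
    intro x
    have := Tendsto.inner (𝕜 := ℝ) hw (tendsto_const_nhds (x := x))
    simpa only [real_inner_smul_left] using this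
  have hw1 : ‖w‖ = 1 := by
    refine tendsto_nhds_unique hw.norm (tendsto_const_nhds.congr' ?_)
    filter_upwards [hpos] with t ht
    rw [norm_smul, norm_inv, norm_norm, inv_mul_cancel₀ ht.ne']
  refine ⟨hw1, ?_⟩
  obtain ⟨ms, hms, hmin⟩ := I.exists_min_image (fun m => inner ℝ w (z m)) hI
  set m₀ : ℝ := inner ℝ w (z ms) with hm₀
  -- The lower bound `-K` on the scores vanishes after division by `‖p t‖ → ∞`.
  have hm₀nn : 0 ≤ m₀ := by
    have h0 : Tendsto (fun t => ‖p t‖⁻¹ * -K) atTop (𝓝 0) := by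
      simpa using (tendsto_inv_atTop_zero.comp hnorm).mul_const (-K)
    refine le_of_tendsto_of_tendsto h0 (hinner (z ms)) ?_
    filter_upwards [eventually_ge_atTop 0] with t ht
    exact mul_le_mul_of_nonneg_left (hK t ht ms hms) (by positivity)
  have hcpos : ∀ t, 0 ≤ t → ∀ m ∈ I, 0 ≤ c m t := fun t ht m hm =>
    (mul_nonneg hb₁.le (Real.exp_pos _).le).trans (hc₁ t ht m hm)
  have key : ∀ ε : ℝ, 0 < ε → 1 ≤ (m₀ + ε) * inner ℝ w u := by
    intro ε hε
    have hcard : (0 : ℝ) < I.card := by exact_mod_cast hI.card_pos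
    -- A direction whose limit margin exceeds the least one has weight exponentially smaller than
    -- that of `ms`. Sharing `ε` among the `I.card` directions lets the single term of `ms` absorb
    -- all these errors.
    have hsmall : ∀ᶠ t in atTop, ∀ m ∈ I, m₀ + ε < inner ℝ w (z m) →
        c m t * inner ℝ w (z m) ≤ ε / I.card * c ms t := by
      rw [Filter.eventually_all_finset]
      intro m hm
      by_cases hbig : m₀ + ε < inner ℝ w (z m)
      swap
      · exact Eventually.of_forall fun t h => absurd h hbig
      have hA : Tendsto (fun t => inner ℝ (p t) (z m - z ms)) atTop atTop := by
        have hl : 0 < inner ℝ w (z m - z ms) := by rw [inner_sub_right]; linarith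
        have := hnorm.atTop_mul_pos hl (hinner (z m - z ms))
        refine this.congr' ?_
        filter_upwards [hpos] with t ht
        rw [← mul_assoc, mul_inv_cancel₀ ht.ne', one_mul]
      have hB : Tendsto (fun t => b₂ * inner ℝ w (z m) *
          Real.exp (-inner ℝ (p t) (z m - z ms))) atTop (𝓝 0) := by
        simpa using (Real.tendsto_exp_neg_atTop_nhds_zero.comp hA).const_mul
          (b₂ * inner ℝ w (z m))
      have hpos' : 0 < ε / I.card * b₁ := by positivity
      filter_upwards [hB.eventually_lt_const hpos', eventually_ge_atTop 0] with t h1 ht _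
      have hwz : 0 ≤ inner ℝ w (z m) := by linarith
      have he : Real.exp (-inner ℝ (p t) (z m)) =
          Real.exp (-inner ℝ (p t) (z m - z ms)) * Real.exp (-inner ℝ (p t) (z ms)) := by
        rw [← Real.exp_add, inner_sub_right]; congr 1; ring
      calc c m t * inner ℝ w (z m)
          ≤ b₂ * Real.exp (-inner ℝ (p t) (z m)) * inner ℝ w (z m) :=
            mul_le_mul_of_nonneg_right (hc₂ t ht m hm) hwz
        _ = (b₂ * inner ℝ w (z m) * Real.exp (-inner ℝ (p t) (z m - z ms))) *
              Real.exp (-inner ℝ (p t) (z ms)) := by rw [he]; ring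
        _ ≤ ε / I.card * b₁ * Real.exp (-inner ℝ (p t) (z ms)) :=
            mul_le_mul_of_nonneg_right h1.le (Real.exp_pos _).le
        _ = ε / I.card * (b₁ * Real.exp (-inner ℝ (p t) (z ms))) := by ring
        _ ≤ ε / I.card * c ms t :=
            mul_le_mul_of_nonneg_left (hc₁ t ht ms hms) (by positivity)
    obtain ⟨t₀, ht₀, ht₀'⟩ : ∃ t₀ : ℝ, 0 ≤ t₀ ∧ ∀ t, t₀ ≤ t → ∀ m ∈ I,
        m₀ + ε < inner ℝ w (z m) → c m t * inner ℝ w (z m) ≤ ε / I.card * c ms t := by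
      obtain ⟨t₀, h⟩ := eventually_atTop.1 hsmall
      exact ⟨max t₀ 0, le_max_right _ _, fun t ht => h t ((le_max_left _ _).trans ht)⟩
    -- Eventually `⟪p, g⟫` is nondecreasing: near-minimal directions contribute nonnegatively since
    -- `⟪u, z m⟫ ≥ 1`, and `ms` contributes at least `ε c ms`, which pays for the others. Dividing
    -- by `‖p t‖` gives `⟪w, g⟫ ≥ 0`, which is the claim since `‖w‖ = 1`.
    set g : F := (m₀ + ε) • u - w with hg
    have hder : ∀ t, 0 ≤ t → HasDerivWithinAt (fun t => inner ℝ (p t) g)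
        (inner ℝ (∑ m ∈ I, c m t • z m) g) (Set.Ici 0) t := fun t ht =>
      hasDerivWithinAt_inner_const g (hp t ht)
    have hterm : ∀ m, inner ℝ (z m) g = (m₀ + ε) * inner ℝ u (z m) - inner ℝ w (z m) := fun m => by
      rw [hg, inner_sub_right, inner_smul_right, real_inner_comm u, real_inner_comm w]
    have hnn : ∀ t, t₀ ≤ t → 0 ≤ inner ℝ (∑ m ∈ I, c m t • z m) g := by
      intro t ht
      have ht0 := ht₀.trans ht
      have hδ : 0 ≤ ε / I.card * c ms t := mul_nonneg (by positivity) (hcpos t ht0 ms hms)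
      have hlow : ∀ m ∈ I, 0 ≤ c m t * inner ℝ (z m) g + ε / I.card * c ms t := by
        intro m hm
        have hcm := hcpos t ht0 m hm
        have hum := hu m hm
        rw [hterm]
        have h1 : (m₀ + ε) * 1 ≤ (m₀ + ε) * inner ℝ u (z m) :=
          mul_le_mul_of_nonneg_left hum (by linarith)
        by_cases hbig : m₀ + ε < inner ℝ w (z m)
        · have h2 := ht₀' t ht m hm hbig
          have h3 : 0 ≤ c m t * ((m₀ + ε) * inner ℝ u (z m)) :=
            mul_nonneg hcm (by linarith)
          rw [mul_sub]
          linarith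
        · have h3 : 0 ≤ c m t * ((m₀ + ε) * inner ℝ u (z m) - inner ℝ w (z m)) :=
            mul_nonneg hcm (by linarith)
          linarith
      have h4 := Finset.single_le_sum hlow hms
      rw [Finset.sum_add_distrib, Finset.sum_const, nsmul_eq_mul, ← mul_assoc,
        mul_div_cancel₀ _ hcard.ne'] at h4
      simp only [sum_inner, real_inner_smul_left]
      have h5 : ε * c ms t ≤ c ms t * inner ℝ (z ms) g := by
        rw [hterm, mul_comm]
        refine mul_le_mul_of_nonneg_left ?_ (hcpos t ht0 ms hms)
        have h1 : (m₀ + ε) * 1 ≤ (m₀ + ε) * inner ℝ u (z ms) :=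
          mul_le_mul_of_nonneg_left (hu ms hms) (by linarith)
        linarith
      linarith
    have hφ : ∀ t, t₀ ≤ t → inner ℝ (p t₀) g ≤ inner ℝ (p t) g := fun t ht => by
      have := mul_sub_le_of_deriv_ge ht₀ hder hnn ht
      linarith
    have h0 : Tendsto (fun t => ‖p t‖⁻¹ * inner ℝ (p t₀) g) atTop (𝓝 0) := by
      simpa using (tendsto_inv_atTop_zero.comp hnorm).mul_const (inner ℝ (p t₀) g)
    have h1 : 0 ≤ inner ℝ w g := by
      refine le_of_tendsto_of_tendsto h0 (hinner g) ?_
      filter_upwards [eventually_ge_atTop t₀] with t ht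
      exact mul_le_mul_of_nonneg_left (hφ t ht) (by positivity)
    rw [hg, inner_sub_right, inner_smul_right, real_inner_self_eq_norm_sq, hw1] at h1
    linarith
  have hfin : 1 ≤ m₀ * inner ℝ w u := by
    have hlim : Tendsto (fun ε : ℝ => (m₀ + ε) * inner ℝ w u) (𝓝[>] 0)
        (𝓝 ((m₀ + 0) * inner ℝ w u)) :=
      ((continuous_const.add continuous_id).mul continuous_const).continuousAt.mono_left
        nhdsWithin_le_nhds
    rw [add_zero] at hlim
    exact ge_of_tendsto hlim (eventually_mem_nhdsWithin.mono fun ε hε => key ε hε)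
  refine ⟨m₀, hmin, lt_of_le_of_ne hm₀nn ?_, hfin⟩
  intro h
  rw [← h, zero_mul] at hfin
  linarith

end AbstractFlow

/-! ### The attention flow as an exponential-weight flow -/

section AttentionFlow

variable {S : Type*} {n T d : ℕ} {X : Fin n → Fin T → S} {y : Fin n → ℝ}
  {v : EuclideanSpace ℝ (Fin d)} {E : S → EuclideanSpace ℝ (Fin d)}

/-- Along the flow the loss has derivative `-‖∇‖²`. -/
theorem loss_le_of_isGradientFlow (hT : 0 < T) {pInit : EuclideanSpace ℝ (Fin d)}
    {p : ℝ → EuclideanSpace ℝ (Fin d)} (hp : IsGradientFlow X y v E pInit p) {t : ℝ}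
    (ht : 0 ≤ t) : loss X y v E (p t) ≤ loss X y v E pInit := by
  have hder : ∀ t, 0 ≤ t → HasDerivWithinAt (fun t => -loss X y v E (p t))
      (‖gradient (fun q => loss X y v E q) (p t)‖ ^ 2) (Set.Ici 0) t := by
    intro t ht
    have hg := hasGradientAt_loss_classification (X := X) (y := y) (v := v) (E := E) (p := p t) hT
    rw [hg.gradient]
    rw [hasGradientAt_iff_hasFDerivAt] at hg
    have hpt := hp.2 t ht
    rw [(hasGradientAt_loss_classification hT).gradient] at hpt
    have := (hg.comp_hasDerivWithinAt t hpt).neg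
    rw [InnerProductSpace.toDual_apply_apply, inner_neg_right, neg_neg,
      real_inner_self_eq_norm_sq] at this
    exact this
  have := mul_sub_le_of_deriv_ge le_rfl hder (κ := 0) (fun s _ => by positivity) ht
  rw [hp.1] at this
  linarith

/-- A margin below `1/2` would already cost `log (1 + e^(-1/2)) ≥ log (3/2) > 0.38`, more than
`e^(-1) < 0.37`, in a single summand. -/
theorem half_le_margin_of_loss_le (hn : 1 ≤ n) {p : EuclideanSpace ℝ (Fin d)}
    (hL : (n : ℝ) * loss X y v E p ≤ Real.exp (-1)) (k : Fin n) :
    1 / 2 ≤ y k * output v E p (X k) := by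
  have hn0 : (n : ℝ) ≠ 0 := by positivity
  by_contra! h
  unfold loss at hL
  rw [one_div, ← mul_assoc, mul_inv_cancel₀ hn0, one_mul] at hL
  have h1 := (Finset.single_le_sum (f := fun k => Real.log (1 + Real.exp
    (-(y k * output v E p (X k))))) (fun k _ => Real.log_nonneg (by
      have := Real.exp_pos (-(y k * output v E p (X k))); linarith))
    (Finset.mem_univ k)).trans hL
  have h2 : (1 / 2 : ℝ) ≤ Real.exp (-(y k * output v E p (X k))) := by
    have := Real.add_one_le_exp (-(y k * output v E p (X k)))
    linarith
  have h3 : Real.log (3 / 2) ≤ Real.log (1 + Real.exp (-(y k * output v E p (X k)))) :=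
    Real.log_le_log (by norm_num) (by linarith)
  have h4 : Real.log (3 / 2) ≤ Real.exp (-1) := h3.trans h1
  have h5 : Real.exp (-1) < 0.37 := by
    rw [Real.exp_neg, inv_lt_comm₀ (Real.exp_pos _) (by norm_num)]
    have := Real.exp_one_gt_d9
    norm_num at this ⊢
    linarith
  have h6 : (0.38 : ℝ) ≤ Real.log (3 / 2) := by
    have h7 : (2 : ℝ) ≤ Real.log ((3 / 2) ^ 5) := by
      rw [Real.le_log_iff_exp_le (by positivity), ← Nat.cast_ofNat (n := 2), ← mul_one ((2 : ℕ) : ℝ),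
        Real.exp_nat_mul]
      exact (pow_le_pow_left₀ (Real.exp_pos 1).le Real.exp_one_lt_d9.le 2).trans (by norm_num)
    rw [Real.log_pow] at h7
    norm_num at h7 ⊢
    linarith
  linarith

/-- The descent direction is a combination of the differences between the embedding of a reference
token and those of the other tokens. -/
theorem neg_gradient_eq_sum (hT : 0 < T) (star : Fin n → Fin T)
    (p : EuclideanSpace ℝ (Fin d)) :
    -gradient (fun q => loss X y v E q) p =
      ∑ m ∈ Finset.univ.filter (fun m : Fin n × Fin T => m.2 ≠ star m.1),
        ((1 / (n : ℝ)) * (residual X y v E p m.1 * (weight E p (X m.1) m.2 *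
          (y m.1 * output v E p (X m.1) - y m.1 * inner ℝ (E (X m.1 m.2)) v)))) •
            (E (X m.1 (star m.1)) - E (X m.1 m.2)) := by
  rw [(hasGradientAt_loss_classification hT).gradient, neg_neg, Finset.sum_filter,
    ← Finset.univ_product_univ, Finset.sum_product, Finset.smul_sum]
  refine Finset.sum_congr rfl fun k _ => ?_
  -- Values centred at their weighted mean have zero average, so a fixed reference embedding may be
  -- subtracted from each `E (X k i)`.
  have h0 : ∑ i, weight E p (X k) i * (inner ℝ (E (X k i)) v - output v E p (X k)) = 0 := by
    simp only [mul_sub, Finset.sum_sub_distrib, ← Finset.sum_mul, sum_weight E p hT, one_mul]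
    rw [output_eq, sub_self]
  have h1 : ∑ i, (weight E p (X k) i * (inner ℝ (E (X k i)) v - output v E p (X k))) •
      E (X k i) = ∑ i, (weight E p (X k) i * (output v E p (X k) - inner ℝ (E (X k i)) v)) •
        (E (X k (star k)) - E (X k i)) := by
    have h2 : (∑ i, weight E p (X k) i * (inner ℝ (E (X k i)) v - output v E p (X k))) •
      E (X k (star k)) = 0 := by rw [h0, zero_smul]
    rw [← sub_eq_zero, ← h2, Finset.sum_smul, ← Finset.sum_sub_distrib]
    refine Finset.sum_congr rfl fun i _ => ?_
    module
  rw [h1, Finset.smul_sum, Finset.smul_sum]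
  refine Finset.sum_congr rfl fun i _ => ?_
  split_ifs with h
  · module
  · rw [not_not] at h
    have h' : i = star k := h
    simp [h']

/-- The margins stay above `1/2` while the other tokens have value at most `1/4`. The gap of at
least `1/4` makes every coefficient in `neg_gradient_eq_sum` positive, and bounds on the attention
to the reference token make it comparable to an exponential. -/
theorem direction_of_isGradientFlow (hn : 1 ≤ n) (hT : 2 ≤ T) (hy : ∀ k, y k = 1 ∨ y k = -1)
    {star : Fin n → Fin T} (hγ : ∀ k j, j ≠ star k → |inner ℝ (E (X k j)) v| ≤ 1 / 4)
    {pInit : EuclideanSpace ℝ (Fin d)} (hL : (n : ℝ) * loss X y v E pInit ≤ Real.exp (-1))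
    {p : ℝ → EuclideanSpace ℝ (Fin d)} (hp : IsGradientFlow X y v E pInit p)
    {u w : EuclideanSpace ℝ (Fin d)}
    (hu : ∀ k j, j ≠ star k → 1 ≤ inner ℝ u (E (X k (star k)) - E (X k j)))
    (hw : Tendsto (fun t => ‖p t‖⁻¹ • p t) atTop (𝓝 w)) :
    ‖w‖ = 1 ∧ ∃ m₀ : ℝ, (∀ k j, j ≠ star k → m₀ ≤ inner ℝ w (E (X k (star k)) - E (X k j))) ∧
      0 < m₀ ∧ 1 ≤ m₀ * inner ℝ w u := by
  have hT0 : 0 < T := by omega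
  have hnpos : (0 : ℝ) < n := by exact_mod_cast hn
  obtain ⟨M, hM1, hM⟩ : ∃ M : ℝ, 1 ≤ M ∧ ∀ k i, |inner ℝ (E (X k i)) v| ≤ M := by
    refine ⟨1 + ∑ m : Fin n × Fin T, |inner ℝ (E (X m.1 m.2)) v|, ?_, fun k i => ?_⟩
    · have : 0 ≤ ∑ m : Fin n × Fin T, |inner ℝ (E (X m.1 m.2)) v| :=
        Finset.sum_nonneg fun _ _ => abs_nonneg _
      linarith
    · have := Finset.single_le_sum (f := fun m : Fin n × Fin T => |inner ℝ (E (X m.1 m.2)) v|)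
        (fun _ _ => abs_nonneg _) (Finset.mem_univ (k, i))
      simp only at this
      linarith
  have habs : ∀ k r, |y k * r| = |r| := fun k r => by
    rw [abs_mul]; rcases hy k with h | h <;> simp [h]
  have hmargin : ∀ t, 0 ≤ t → ∀ k, 1 / 2 ≤ y k * output v E (p t) (X k) := fun t ht k =>
    half_le_margin_of_loss_le hn (le_trans (mul_le_mul_of_nonneg_left
      (loss_le_of_isGradientFlow hT0 hp ht) hnpos.le) hL) k
  have hyout : ∀ t k, y k * output v E (p t) (X k) =
      ∑ i, weight E (p t) (X k) i * (y k * inner ℝ (E (X k i)) v) := fun t k => by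
    rw [output_eq, Finset.mul_sum]
    exact Finset.sum_congr rfl fun i _ => by ring
  have hupper : ∀ t k, y k * output v E (p t) (X k) ≤ M := fun t k => by
    rw [hyout]
    calc _ ≤ ∑ i, weight E (p t) (X k) i * M := Finset.sum_le_sum fun i _ =>
          mul_le_mul_of_nonneg_left ((le_abs_self _).trans ((habs _ _).trans_le (hM k i)))
            (weight_nonneg _ _ _ _)
      _ = M := by rw [← Finset.sum_mul, sum_weight _ _ hT0, one_mul]
  -- The other tokens supply at most `1/4` of a margin of at least `1/2`; the reference token, of
  -- value at most `M`, supplies the rest.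
  have hstar : ∀ t, 0 ≤ t → ∀ k, 1 / (4 * M) ≤ weight E (p t) (X k) (star k) := by
    intro t ht k
    have h1 : ∑ i, weight E (p t) (X k) i * (y k * inner ℝ (E (X k i)) v) ≤
        ∑ i, (weight E (p t) (X k) i * (1 / 4) +
          if i = star k then weight E (p t) (X k) i * M else 0) := by
      refine Finset.sum_le_sum fun i _ => ?_
      have hw0 := weight_nonneg E (p t) (X k) i
      have h2 := (le_abs_self _).trans_eq (habs k (inner ℝ (E (X k i)) v))
      split_ifs with hi
      · nlinarith [hM k i]
      · nlinarith [hγ k i hi]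
    rw [← hyout, Finset.sum_add_distrib, ← Finset.sum_mul, sum_weight _ _ hT0,
      Finset.sum_ite_eq' Finset.univ (star k), if_pos (Finset.mem_univ _)] at h1
    have := hmargin t ht k
    rw [div_le_iff₀ (by positivity)]
    linarith
  have hweight : ∀ t k j, weight E (p t) (X k) j = weight E (p t) (X k) (star k) *
      Real.exp (-inner ℝ (p t) (E (X k (star k)) - E (X k j))) := fun t k j => by
    unfold weight
    rw [div_mul_eq_mul_div, ← Real.exp_add, inner_sub_right]
    congr 2
    ring
  set I := Finset.univ.filter (fun m : Fin n × Fin T => m.2 ≠ star m.1) with hI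
  have hmemI : ∀ m, m ∈ I ↔ m.2 ≠ star m.1 := fun m => by simp [hI]
  have hIne : I.Nonempty := by
    have : Nontrivial (Fin T) := Fin.nontrivial_iff_two_le.2 hT
    obtain ⟨j, hj⟩ := exists_ne (star ⟨0, hn⟩)
    exact ⟨(⟨0, hn⟩, j), (hmemI _).2 hj⟩
  have hgap : ∀ t, 0 ≤ t → ∀ k j, j ≠ star k → 1 / 4 ≤
      y k * output v E (p t) (X k) - y k * inner ℝ (E (X k j)) v ∧
      y k * output v E (p t) (X k) - y k * inner ℝ (E (X k j)) v ≤ 2 * M := by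
    intro t ht k j hj
    have h1 := hmargin t ht k
    have h2 := abs_le.1 ((habs k _).trans_le (hγ k j hj))
    have h3 := abs_le.1 ((habs k _).trans_le (hM k j))
    have h4 := hupper t k
    constructor <;> linarith
  have hres : ∀ t k, (1 + Real.exp M)⁻¹ ≤ residual X y v E (p t) k := fun t k => by
    unfold residual
    have := hupper t k
    gcongr
  have hexpM := Real.exp_pos M
  -- `b₁` and `b₂` multiply the bounds on residual, reference weight and value gap. `K = log (4M)`
  -- because `exp (-⟪p, z⟫)` is a quotient of a weight at most `1` by one at least `1/(4M)`.
  obtain ⟨hw1, m₀, hm₀, hpos, hle⟩ := margin_of_exp_flow (p := p) (I := I) (u := u) (w := w)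
    (z := fun m => E (X m.1 (star m.1)) - E (X m.1 m.2))
    (c := fun m t => (1 / (n : ℝ)) * (residual X y v E (p t) m.1 * (weight E (p t) (X m.1) m.2 *
          (y m.1 * output v E (p t) (X m.1) - y m.1 * inner ℝ (E (X m.1 m.2)) v))))
    (b₁ := (1 / (n : ℝ)) * ((1 + Real.exp M)⁻¹ * (1 / (4 * M) * (1 / 4))))
    (b₂ := (1 / (n : ℝ)) * (1 * (1 * (2 * M)))) (K := Real.log (4 * M)) hIne
    (fun t ht => by rw [← neg_gradient_eq_sum hT0 star]; exact hp.2 t ht)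
    (by positivity)
    (fun t ht m hm => by
      have hm' := (hmemI m).1 hm
      obtain ⟨h1, h2⟩ := hgap t ht m.1 m.2 hm'
      have h3 := hres t m.1
      have h4 := hstar t ht m.1
      have h5 := weight_pos E (p t) (X m.1) (star m.1)
      have h6 := residual_pos X y v E (p t) m.1
      rw [hweight t m.1 m.2]
      calc _ = (1 / (n : ℝ)) * ((1 + Real.exp M)⁻¹ * ((1 / (4 * M) *
            Real.exp (-inner ℝ (p t) (E (X m.1 (star m.1)) - E (X m.1 m.2)))) * (1 / 4))) := by
              ring
        _ ≤ _ := by gcongr)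
    (fun t ht m hm => by
      have hm' := (hmemI m).1 hm
      obtain ⟨h1, h2⟩ := hgap t ht m.1 m.2 hm'
      have h3 := residual_le_one X y v E (p t) m.1
      have h4 := weight_le_one E (p t) (X m.1) (star m.1)
      have h5 := weight_pos E (p t) (X m.1) (star m.1)
      have h6 := residual_pos X y v E (p t) m.1
      rw [hweight t m.1 m.2]
      calc _ ≤ (1 / (n : ℝ)) * (1 * ((1 *
            Real.exp (-inner ℝ (p t) (E (X m.1 (star m.1)) - E (X m.1 m.2)))) * (2 * M))) := by
              gcongr
        _ = _ := by ring)
    (fun t ht m hm => by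
      have h1 := hweight t m.1 m.2
      have h2 := hstar t ht m.1
      have h3 := weight_le_one E (p t) (X m.1) m.2
      rw [h1] at h3
      have h4 : Real.exp (-inner ℝ (p t) (E (X m.1 (star m.1)) - E (X m.1 m.2))) ≤ 4 * M := by
        have h5 := mul_le_mul_of_nonneg_right h2
          (Real.exp_pos (-inner ℝ (p t) (E (X m.1 (star m.1)) - E (X m.1 m.2)))).le
        have h6 := h5.trans h3
        rwa [div_mul_eq_mul_div, one_mul, div_le_one (by positivity)] at h6
      have := (Real.le_log_iff_exp_le (by positivity)).2 h4
      linarith)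
    (fun m hm => hu m.1 m.2 ((hmemI m).1 hm)) hw
  exact ⟨hw1, m₀, fun k j hj => hm₀ (k, j) ((hmemI _).2 hj), hpos, hle⟩

end AttentionFlow

/-! ### First-order analysis of one gradient step -/

section OneStep

variable {S : Type*} {n T d : ℕ}

/-- Near-orthogonality of the initial embeddings, up to `τ`, with control of their norms. -/
structure NearOrthogonal (τ : ℝ) (v : EuclideanSpace ℝ (Fin d)) (E : S → EuclideanSpace ℝ (Fin d))
    (p : EuclideanSpace ℝ (Fin d)) : Prop where
  inner_token_v : ∀ s, |inner ℝ (E s) v| ≤ τ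
  inner_p_v : |inner ℝ p v| ≤ τ
  inner_p_token : ∀ s, |inner ℝ p (E s)| ≤ τ
  inner_token_token : ∀ s s', s ≠ s' → |inner ℝ (E s) (E s')| ≤ τ
  le_norm_sq_token : ∀ s, 1 / 4 ≤ ‖E s‖ ^ 2
  norm_sq_token_le : ∀ s, ‖E s‖ ^ 2 ≤ 4
  norm_sq_p_le : ‖p‖ ^ 2 ≤ 4

theorem abs_average_le (hn : 1 ≤ n) {r : Fin n → ℝ} {C : ℝ} (h : ∀ k, |r k| ≤ C) :
    |(1 / (n : ℝ)) * ∑ k, r k| ≤ C := by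
  have hn0 : (0 : ℝ) < n := by exact_mod_cast hn
  rw [abs_mul, abs_of_pos (by positivity), one_div, inv_mul_le_iff₀ hn0]
  calc |∑ k, r k| ≤ ∑ k, |r k| := Finset.abs_sum_le_sum_abs _ _
    _ ≤ ∑ _k : Fin n, C := Finset.sum_le_sum fun k _ => h k
    _ = n * C := by simp

theorem abs_mul_label {y r : ℝ} (hy : y = 1 ∨ y = -1) : |y * r| = |r| := by
  rw [abs_mul]; rcases hy with h | h <;> simp [h]

/-- Small scores give almost uniform attention. -/
theorem abs_weight_sub_one_le {E : S → EuclideanSpace ℝ (Fin d)}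
    {p : EuclideanSpace ℝ (Fin d)} {σ : ℝ} (hσ : σ ≤ 1 / 2) (h : ∀ s, |inner ℝ p (E s)| ≤ σ)
    (x : Fin T → S) (i : Fin T) : |(T : ℝ) * weight E p x i - 1| ≤ 4 * σ := by
  have hT : (0 : ℝ) < T := by exact_mod_cast i.pos
  have hσ0 : 0 ≤ σ := (abs_nonneg _).trans (h (x i))
  have hZ := sum_exp_pos E p x i
  have hlo : ∀ j, Real.exp (-σ) ≤ Real.exp (inner ℝ p (E (x j))) := fun j =>
    Real.exp_le_exp.2 (abs_le.1 (h (x j))).1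
  have hup : ∀ j, Real.exp (inner ℝ p (E (x j))) ≤ Real.exp σ := fun j =>
    Real.exp_le_exp.2 (abs_le.1 (h (x j))).2
  have hZlo : (T : ℝ) * Real.exp (-σ) ≤ ∑ j, Real.exp (inner ℝ p (E (x j))) := by
    have := Finset.sum_le_sum fun j (_ : j ∈ Finset.univ) => hlo j
    simpa using this
  have hZup : ∑ j, Real.exp (inner ℝ p (E (x j))) ≤ (T : ℝ) * Real.exp σ := by
    have := Finset.sum_le_sum fun j (_ : j ∈ Finset.univ) => hup j
    simpa using this
  have hp1 : Real.exp (2 * σ) * Real.exp (-σ) = Real.exp σ := by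
    rw [← Real.exp_add]; congr 1; ring
  have hp2 : Real.exp (-(2 * σ)) * Real.exp σ = Real.exp (-σ) := by
    rw [← Real.exp_add]; congr 1; ring
  have h1 : (T : ℝ) * weight E p x i ≤ Real.exp (2 * σ) := by
    unfold weight
    rw [mul_div_assoc', div_le_iff₀ hZ]
    calc (T : ℝ) * Real.exp (inner ℝ p (E (x i))) ≤ T * Real.exp σ := by gcongr; exact (abs_le.1 (h (x i))).2
      _ = Real.exp (2 * σ) * (T * Real.exp (-σ)) := by rw [← hp1]; ring
      _ ≤ _ := by gcongr
  have h2 : Real.exp (-(2 * σ)) ≤ (T : ℝ) * weight E p x i := by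
    unfold weight
    rw [mul_div_assoc', le_div_iff₀ hZ]
    calc _ ≤ Real.exp (-(2 * σ)) * (T * Real.exp σ) := by gcongr
      _ = T * Real.exp (-σ) := by rw [← hp2]; ring
      _ ≤ _ := by gcongr; exact (abs_le.1 (h (x i))).1
  have h3 := abs_le.1 (Real.abs_exp_sub_one_le (x := 2 * σ) (by
    rw [abs_of_nonneg (by positivity)]; linarith))
  have h4 := abs_le.1 (Real.abs_exp_sub_one_le (x := -(2 * σ)) (by
    rw [abs_neg, abs_of_nonneg (by positivity)]; linarith))
  rw [abs_neg, abs_of_nonneg (by positivity)] at h4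
  rw [abs_of_nonneg (by positivity)] at h3
  rw [abs_le]
  constructor <;> linarith [h3.2, h4.1]

theorem abs_inv_one_add_exp_sub_half_le {r : ℝ} (hr : |r| ≤ 1) :
    |(1 + Real.exp r)⁻¹ - 1 / 2| ≤ |r| := by
  have he := Real.exp_pos r
  have h1 := Real.abs_exp_sub_one_le hr
  have h2 : (1 + Real.exp r)⁻¹ - 1 / 2 = -(Real.exp r - 1) / (2 * (1 + Real.exp r)) := by
    field_simp
    ring
  rw [h2, abs_div, abs_neg, abs_of_pos (a := 2 * (1 + Real.exp r)) (by positivity),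
    div_le_iff₀ (by positivity)]
  nlinarith [abs_nonneg r]

variable {X : Fin n → Fin T → S} {y : Fin n → ℝ} {v : EuclideanSpace ℝ (Fin d)}
    {E : S → EuclideanSpace ℝ (Fin d)} {p : EuclideanSpace ℝ (Fin d)} {τ η : ℝ}

theorem abs_output_le {E' : S → EuclideanSpace ℝ (Fin d)} {p' : EuclideanSpace ℝ (Fin d)}
    (hT : 0 < T) {C : ℝ} (h : ∀ s, |inner ℝ (E' s) v| ≤ C) (x : Fin T → S) :
    |output v E' p' x| ≤ C := by
  rw [output_eq]
  calc _ ≤ ∑ i, |weight E' p' x i * inner ℝ (E' (x i)) v| := Finset.abs_sum_le_sum_abs _ _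
    _ ≤ ∑ i, weight E' p' x i * C := Finset.sum_le_sum fun i _ => by
        rw [abs_mul, abs_of_nonneg (weight_nonneg _ _ _ _)]
        exact mul_le_mul_of_nonneg_left (h _) (weight_nonneg _ _ _ _)
    _ = C := by rw [← Finset.sum_mul, sum_weight _ _ hT, one_mul]

theorem abs_label_mul_residual_mul_le {k : Fin n} (hy : y k = 1 ∨ y k = -1) {r C : ℝ}
    (h : |r| ≤ C) : |y k * residual X y v E p k * r| ≤ C := by
  rw [mul_assoc, abs_mul_label hy, abs_mul, abs_of_pos (residual_pos _ _ _ _ _ _)]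
  have h1 := residual_le_one X y v E p k
  have h2 := (residual_pos X y v E p k).le
  have h3 := abs_nonneg r
  nlinarith

/-- The step of `p` averages embeddings with attention weights times centred values, and the latter
are at most `2τ`. -/
theorem abs_inner_stepP_sub_le (hn : 1 ≤ n) (hT : 0 < T) (hy : ∀ k, y k = 1 ∨ y k = -1)
    (hη : 0 ≤ η) (h : ∀ s, |inner ℝ (E s) v| ≤ τ) {x : EuclideanSpace ℝ (Fin d)} {C : ℝ}
    (hx : ∀ s, |inner ℝ (E s) x| ≤ C) :
    |inner ℝ (stepP X y v η E p) x - inner ℝ p x| ≤ η * (2 * τ * C) := by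
  unfold stepP
  rw [(hasGradientAt_loss_classification hT).gradient, smul_neg, sub_neg_eq_add, inner_add_left,
    add_sub_cancel_left, real_inner_smul_left, abs_mul, abs_of_nonneg hη]
  refine mul_le_mul_of_nonneg_left ?_ hη
  rw [real_inner_smul_left, sum_inner]
  refine abs_average_le hn fun k => ?_
  rw [real_inner_smul_left]
  refine abs_label_mul_residual_mul_le (hy k) ?_
  rw [sum_inner]
  calc _ ≤ ∑ i, |inner ℝ ((weight E p (X k) i *
          (inner ℝ (E (X k i)) v - output v E p (X k))) • E (X k i)) x| :=
        Finset.abs_sum_le_sum_abs _ _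
    _ ≤ ∑ i, weight E p (X k) i * (2 * τ * C) := Finset.sum_le_sum fun i _ => by
        have h0 := weight_nonneg E p (X k) i
        rw [real_inner_smul_left, abs_mul, abs_mul, abs_of_nonneg h0, mul_assoc]
        refine mul_le_mul_of_nonneg_left ?_ h0
        have h1 : |inner ℝ (E (X k i)) v - output v E p (X k)| ≤ 2 * τ := by
          refine (abs_sub _ _).trans ?_
          linarith [h (X k i), abs_output_le (p' := p) hT h (X k)]
        exact mul_le_mul h1 (hx _) (abs_nonneg _) ((abs_nonneg _).trans h1)
    _ = 2 * τ * C := by rw [← Finset.sum_mul, sum_weight _ _ hT, one_mul]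

variable [DecidableEq S] (X y v E p)

/-- Coefficient of `v` in the descent direction of the embedding of `s`. -/
noncomputable def coeffV (s : S) : ℝ :=
  (1 / (n : ℝ)) * ∑ k, y k * residual X y v E p k *
    ∑ i, if X k i = s then weight E p (X k) i else 0

/-- Coefficient of `p` in the descent direction of the embedding of `s`. -/
noncomputable def coeffP (s : S) : ℝ :=
  (1 / (n : ℝ)) * ∑ k, y k * residual X y v E p k *
    ∑ i, if X k i = s then
      weight E p (X k) i * (inner ℝ (E s) v - output v E p (X k)) else 0

variable {X y v E p}

theorem stepE_eq (hT : 0 < T) (η : ℝ) (s : S) :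
    stepE X y v η E p s = E s + (η * coeffV X y v E p s) • v + (η * coeffP X y v E p s) • p := by
  unfold stepE
  rw [(hasGradientAt_loss_token hT s).gradient, smul_neg, sub_neg_eq_add, add_assoc]
  congr 1
  unfold coeffV coeffP
  rw [mul_smul η, mul_smul η, ← smul_add, mul_smul (1 / (n : ℝ)), mul_smul (1 / (n : ℝ)),
    ← smul_add, Finset.sum_smul, Finset.sum_smul, ← Finset.sum_add_distrib]
  congr 2
  refine Finset.sum_congr rfl fun k _ => ?_
  rw [mul_smul (y k * residual X y v E p k), mul_smul (y k * residual X y v E p k), ← smul_add,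
    Finset.sum_smul, Finset.sum_smul, ← Finset.sum_add_distrib]
  congr 1
  refine Finset.sum_congr rfl fun i _ => ?_
  split_ifs
  · rw [smul_add, smul_smul]
  · simp

theorem abs_coeffV_le (hn : 1 ≤ n) (hT : 0 < T) (hy : ∀ k, y k = 1 ∨ y k = -1) (s : S) :
    |coeffV X y v E p s| ≤ 1 := by
  refine abs_average_le hn fun k => abs_label_mul_residual_mul_le (hy k) ?_
  rw [← sum_weight E p hT (X k), abs_of_nonneg]
  · refine Finset.sum_le_sum fun i _ => ?_
    have := weight_nonneg E p (X k) i
    split_ifs <;> simp [this]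
  · refine Finset.sum_nonneg fun i _ => ?_
    have := weight_nonneg E p (X k) i
    split_ifs <;> simp [this]

theorem abs_coeffP_le (hn : 1 ≤ n) (hT : 0 < T) (hy : ∀ k, y k = 1 ∨ y k = -1)
    (h : ∀ s, |inner ℝ (E s) v| ≤ τ) (s : S) : |coeffP X y v E p s| ≤ 2 * τ := by
  refine abs_average_le hn fun k => abs_label_mul_residual_mul_le (hy k) ?_
  have hτ := (abs_nonneg _).trans (h s)
  calc _ ≤ ∑ i, |if X k i = s then
          weight E p (X k) i * (inner ℝ (E s) v - output v E p (X k)) else 0| :=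
        Finset.abs_sum_le_sum_abs _ _
    _ ≤ ∑ i, weight E p (X k) i * (2 * τ) := Finset.sum_le_sum fun i _ => by
        have h0 := weight_nonneg E p (X k) i
        split_ifs
        · rw [abs_mul, abs_of_nonneg h0]
          refine mul_le_mul_of_nonneg_left ((abs_sub _ _).trans ?_) h0
          linarith [h s, abs_output_le (p' := p) hT h (X k)]
        · rw [abs_zero]; positivity
    _ = 2 * τ := by rw [← Finset.sum_mul, sum_weight _ _ hT, one_mul]

/-- With weights exactly `1/T` and residuals exactly `1/2` the coefficient would be half the signed
frequency. The attention error contributes `4τ` and the residual error `τ`. -/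
theorem abs_coeffV_sub_le (hn : 1 ≤ n) (hT : 0 < T) (hy : ∀ k, y k = 1 ∨ y k = -1)
    (hτ : τ ≤ 1 / 2) (h : ∀ s, |inner ℝ (E s) v| ≤ τ) (hp : ∀ s, |inner ℝ p (E s)| ≤ τ) (s : S) :
    |coeffV X y v E p s - signedFreq X y s / 2| ≤ 5 * τ := by
  have hT' : (0 : ℝ) < T := by exact_mod_cast hT
  have hn' : (0 : ℝ) < n := by exact_mod_cast hn
  have hτ0 := (abs_nonneg _).trans (h s)
  have heq : coeffV X y v E p s - signedFreq X y s / 2 = (1 / (n : ℝ)) * ∑ k, y k *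
      ∑ i, if X k i = s then
        (residual X y v E p k * weight E p (X k) i - 1 / (2 * T)) else 0 := by
    have h1 : signedFreq X y s / 2 = (1 / (n : ℝ)) * ∑ k, y k *
        ∑ i, if X k i = s then 1 / (2 * (T : ℝ)) else 0 := by
      unfold signedFreq
      have : ∀ k, y k * ∑ i, (if X k i = s then 1 / (2 * (T : ℝ)) else 0) =
          1 / (2 * (T : ℝ)) * (y k * ∑ i, if X k i = s then (1 : ℝ) else 0) := fun k => by
        rw [mul_left_comm]
        congr 1
        rw [Finset.mul_sum]
        refine Finset.sum_congr rfl fun i _ => ?_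
        split_ifs <;> simp
      simp only [this, ← Finset.mul_sum]
      field_simp
    rw [h1]
    unfold coeffV
    rw [← mul_sub, ← Finset.sum_sub_distrib]
    congr 1
    refine Finset.sum_congr rfl fun k _ => ?_
    rw [mul_assoc, ← mul_sub, Finset.mul_sum, ← Finset.sum_sub_distrib]
    congr 1
    refine Finset.sum_congr rfl fun i _ => ?_
    by_cases hi : X k i = s <;> simp [hi]
  rw [heq]
  refine abs_average_le hn fun k => ?_
  rw [abs_mul_label (hy k)]
  have hres : |residual X y v E p k - 1 / 2| ≤ τ := by
    have h1 : |y k * output v E p (X k)| ≤ τ :=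
      (abs_mul_label (hy k)).trans_le (abs_output_le hT h _)
    exact (abs_inv_one_add_exp_sub_half_le (h1.trans (by linarith))).trans h1
  calc _ ≤ ∑ i, |if X k i = s then
        (residual X y v E p k * weight E p (X k) i - 1 / (2 * (T : ℝ))) else 0| :=
        Finset.abs_sum_le_sum_abs _ _
    _ ≤ ∑ _i : Fin T, 5 * τ / T := Finset.sum_le_sum fun i _ => by
        split_ifs
        · have h2 := abs_weight_sub_one_le hτ hp (X k) i
          have h3 : residual X y v E p k * weight E p (X k) i - 1 / (2 * (T : ℝ)) =
              (residual X y v E p k * (T * weight E p (X k) i - 1) +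
                (residual X y v E p k - 1 / 2)) / T := by
            field_simp; ring
          rw [h3, abs_div, abs_of_pos hT']
          gcongr
          refine (abs_add_le _ _).trans ?_
          rw [abs_mul, abs_of_pos (residual_pos _ _ _ _ _ _)]
          have h4 := residual_le_one X y v E p k
          have h5 := (residual_pos X y v E p k).le
          nlinarith [abs_nonneg ((T : ℝ) * weight E p (X k) i - 1)]
        · rw [abs_zero]; positivity
    _ = 5 * τ := by simp; field_simp

end OneStep

/-! ### Values, scores, loss and separability after one step -/

section UpdatedEmbeddings

variable {S : Type*} {n T d : ℕ} [DecidableEq S] {X : Fin n → Fin T → S} {y : Fin n → ℝ}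
  {v : EuclideanSpace ℝ (Fin d)} {E : S → EuclideanSpace ℝ (Fin d)}
  {p : EuclideanSpace ℝ (Fin d)} {τ η : ℝ}

/-- All occurrences of an important token carry the same label, so nothing cancels and one
occurrence already gives `1/(nT)`. -/
theorem one_div_le_label_mul_signedFreq {k : Fin n} {i : Fin T} (hy : ∀ k, y k = 1 ∨ y k = -1)
    (h : IsImportant X y (X k i)) : 1 / ((n : ℝ) * T) ≤ y k * signedFreq X y (X k i) := by
  have hlab : ∀ k' j, X k' j = X k i → y k' = y k := by
    rcases h with h | h <;> intro k' j hj <;> rw [h k' j hj, h k i rfl]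
  have hone : y k * y k = 1 := by rcases hy k with h | h <;> rw [h] <;> norm_num
  have hT : (0 : ℝ) < T := by exact_mod_cast i.pos
  have hn : (0 : ℝ) < n := by exact_mod_cast k.pos
  have heq : y k * signedFreq X y (X k i) =
      (∑ k', ∑ j, if X k' j = X k i then (1 : ℝ) else 0) / (n * T) := by
    unfold signedFreq
    rw [mul_div_assoc', Finset.mul_sum]
    congr 1
    refine Finset.sum_congr rfl fun k' _ => ?_
    rw [← mul_assoc, Finset.mul_sum]
    refine Finset.sum_congr rfl fun j _ => ?_
    split_ifs with hj
    · rw [hlab k' j hj, hone, one_mul]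
    · rw [mul_zero]
  rw [heq]
  gcongr
  have hnn : ∀ k' j, (0 : ℝ) ≤ if X k' j = X k i then (1 : ℝ) else 0 := fun k' j => by
    split_ifs <;> norm_num
  calc (1 : ℝ) = if X k i = X k i then (1 : ℝ) else 0 := by simp
    _ ≤ ∑ j, if X k j = X k i then (1 : ℝ) else 0 :=
        Finset.single_le_sum (f := fun j => if X k j = X k i then (1 : ℝ) else 0)
          (fun j _ => hnn k j) (Finset.mem_univ i)
    _ ≤ _ := Finset.single_le_sum
          (f := fun k' => ∑ j, if X k' j = X k i then (1 : ℝ) else 0)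
          (fun k' _ => Finset.sum_nonneg fun j _ => hnn k' j) (Finset.mem_univ k)

theorem not_isIrrelevant_of_isImportant {k : Fin n} {i : Fin T} (hy : ∀ k, y k = 1 ∨ y k = -1)
    (h : IsImportant X y (X k i)) : ¬ IsIrrelevant X y (X k i) := by
  intro h0
  have := one_div_le_label_mul_signedFreq hy h
  rw [show signedFreq X y (X k i) = 0 from h0, mul_zero] at this
  have hT : (0 : ℝ) < T := by exact_mod_cast i.pos
  have hn : (0 : ℝ) < n := by exact_mod_cast k.pos
  have : (0 : ℝ) < 1 / (n * T) := by positivity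
  linarith

theorem inner_stepE (hT : 0 < T) (η : ℝ) (s : S) (x : EuclideanSpace ℝ (Fin d)) :
    inner ℝ x (stepE X y v η E p s) = inner ℝ x (E s) + η * coeffV X y v E p s * inner ℝ x v +
      η * coeffP X y v E p s * inner ℝ x p := by
  rw [stepE_eq hT, inner_add_right, inner_add_right, inner_smul_right, inner_smul_right]

theorem abs_coeff_mul_le {η a r A R : ℝ} (hη : 0 ≤ η) (ha : |a| ≤ A) (hr : |r| ≤ R) :
    |η * a * r| ≤ η * (A * R) := by
  rw [abs_mul, abs_mul, abs_of_nonneg hη, mul_assoc]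
  exact mul_le_mul_of_nonneg_left
    (mul_le_mul ha hr (abs_nonneg _) ((abs_nonneg _).trans ha)) hη

namespace NearOrthogonal

theorem abs_inner_stepE_v_sub_le (h : NearOrthogonal τ v E p) (hn : 1 ≤ n) (hT : 0 < T)
    (hy : ∀ k, y k = 1 ∨ y k = -1)
    (hv : ‖v‖ = 1) (hη : 16 ≤ η) (hτ : τ ≤ 1 / 2) (s : S) :
    |inner ℝ (stepE X y v η E p s) v - η * (signedFreq X y s / 2)| ≤ 8 * (η * τ) := by
  have hτ0 := (abs_nonneg _).trans h.inner_p_v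
  have hη0 : 0 ≤ η := by linarith
  rw [real_inner_comm, inner_stepE hT, real_inner_self_eq_norm_sq, hv]
  have h1 : |η * 1 * (coeffV X y v E p s - signedFreq X y s / 2)| ≤ η * (1 * (5 * τ)) :=
    abs_coeff_mul_le hη0 (by simp)
      (abs_coeffV_sub_le hn hT hy hτ h.inner_token_v h.inner_p_token s)
  have h2 := abs_coeff_mul_le hη0 (abs_coeffP_le (X := X) (y := y) (p := p) hn hT hy
    h.inner_token_v s) h.inner_p_v
  rw [real_inner_comm p v]
  have h3 := h.inner_token_v s
  rw [real_inner_comm] at h3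
  have h4 : η * (2 * τ * τ) ≤ η * τ := by nlinarith [mul_nonneg hη0 hτ0]
  have h5 : τ ≤ η * τ := by nlinarith
  rw [abs_le] at h1 h2 h3 ⊢
  constructor <;> linarith [h1.1, h1.2, h2.1, h2.2, h3.1, h3.2]

theorem abs_inner_token_stepE_sub_le (h : NearOrthogonal τ v E p) (hn : 1 ≤ n) (hT : 0 < T)
    (hy : ∀ k, y k = 1 ∨ y k = -1)
    (hη : 16 ≤ η) (hτ : τ ≤ 1 / 2) (t s : S) :
    |inner ℝ (E t) (stepE X y v η E p s) - inner ℝ (E t) (E s)| ≤ 2 * (η * τ) := by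
  have hτ0 := (abs_nonneg _).trans h.inner_p_v
  have hη0 : 0 ≤ η := by linarith
  rw [inner_stepE hT]
  have h1 := abs_coeff_mul_le hη0 (abs_coeffV_le (X := X) (y := y) (v := v) (E := E) (p := p)
    hn hT hy s) (h.inner_token_v t)
  have h2 := abs_coeff_mul_le hη0 (abs_coeffP_le (X := X) (y := y) (p := p) hn hT hy
    h.inner_token_v s) (h.inner_p_token t)
  rw [real_inner_comm p (E t)]
  have h4 : η * (2 * τ * τ) ≤ η * τ := by nlinarith [mul_nonneg hη0 hτ0]
  rw [abs_le] at h1 h2 ⊢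
  constructor <;> linarith [h1.1, h1.2, h2.1, h2.2]

/-- Scores remain small, so attention is still nearly uniform after the step. Moving `p` costs `η ·
2τ · 5`, where `5` bounds `⟪E t, E' s⟫`; the old `p` against the new embedding costs at most another
`10ητ`, mainly from the `p`-component of the update. -/
theorem abs_inner_stepP_stepE_le (h : NearOrthogonal τ v E p) (hn : 1 ≤ n) (hT : 0 < T)
    (hy : ∀ k, y k = 1 ∨ y k = -1)
    (hη : 16 ≤ η) (hητ : η * τ ≤ 1 / 1000) (s : S) :
    |inner ℝ (stepP X y v η E p) (stepE X y v η E p s)| ≤ 20 * (η * τ) := by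
  have hτ0 := (abs_nonneg _).trans h.inner_p_v
  have hη0 : 0 ≤ η := by linarith
  have hτ : τ ≤ 1 / 2 := by nlinarith
  have h5 : 16 * τ ≤ η * τ := by nlinarith
  have hE : ∀ t, |inner ℝ (E t) (stepE X y v η E p s)| ≤ 5 := by
    intro t
    have h1 := h.abs_inner_token_stepE_sub_le (X := X) (y := y) hn hT hy hη hτ t s
    have h2 : |inner ℝ (E t) (E s)| ≤ 4 := by
      by_cases hts : t = s
      · rw [hts, real_inner_self_eq_norm_sq, abs_of_nonneg (by positivity)]
        exact h.norm_sq_token_le s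
      · exact (h.inner_token_token t s hts).trans (by linarith)
    rw [abs_le] at h1 h2 ⊢
    constructor <;> linarith [h1.1, h1.2, h2.1, h2.2]
  have h1 := abs_inner_stepP_sub_le (X := X) (y := y) (p := p) hn hT hy hη0 h.inner_token_v hE
  have h2 : |inner ℝ p (stepE X y v η E p s)| ≤ 10 * (η * τ) := by
    rw [inner_stepE hT]
    have h3 := abs_coeff_mul_le hη0 (abs_coeffV_le (X := X) (y := y) (v := v) (E := E) (p := p)
      hn hT hy s) h.inner_p_v
    have h4 := abs_coeff_mul_le hη0 (abs_coeffP_le (X := X) (y := y) (p := p) hn hT hy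
      h.inner_token_v s) (r := inner ℝ p p) (R := 4) (by
        rw [real_inner_self_eq_norm_sq, abs_of_nonneg (by positivity)]; exact h.norm_sq_p_le)
    have h6 := h.inner_p_token s
    rw [abs_le] at h3 h4 h6 ⊢
    constructor <;> linarith [h3.1, h3.2, h4.1, h4.2, h6.1, h6.2]
  rw [abs_le] at h1 h2 ⊢
  constructor <;> linarith [h1.1, h1.2, h2.1, h2.2]

/-- After one step the loss is small. -/
theorem loss_step_le (h : NearOrthogonal τ v E p) (hn : 1 ≤ n) (hT : 0 < T)
    (hy : ∀ k, y k = 1 ∨ y k = -1)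
    (hv : ‖v‖ = 1) (hη : 16 ≤ η) (hητ : η * τ ≤ 1 / 1000)
    (hηnT : 4 * (n : ℝ) ^ 2 * (T : ℝ) ^ 2 ≤ η) {star : Fin n → Fin T}
    (himp : ∀ k, IsImportant X y (X k (star k)))
    (hirr : ∀ k j, j ≠ star k → IsIrrelevant X y (X k j)) :
    (n : ℝ) * loss X y v (stepE X y v η E p) (stepP X y v η E p) ≤ Real.exp (-1) := by
  have hτ0 := (abs_nonneg _).trans h.inner_p_v
  have hη0 : 0 ≤ η := by linarith
  have hτ : τ ≤ 1 / 2 := by nlinarith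
  have hT' : (1 : ℝ) ≤ T := by exact_mod_cast hT
  have hn' : (1 : ℝ) ≤ n := by exact_mod_cast hn
  set x := η * τ with hx
  have hx0 : 0 ≤ x := mul_nonneg hη0 hτ0
  set E' := stepE X y v η E p with hE'
  set p' := stepP X y v η E p with hp'
  have hγ := h.abs_inner_stepE_v_sub_le (X := X) (y := y) hn hT hy hv hη hτ
  have hscore := h.abs_inner_stepP_stepE_le (X := X) (y := y) hn hT hy hη hητ
  rw [← hE', ← hx] at hγ
  rw [← hE', ← hp', ← hx] at hscore
  have hirrγ : ∀ k j, j ≠ star k → -(8 * x) ≤ y k * inner ℝ (E' (X k j)) v := by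
    intro k j hj
    have h1 := hγ (X k j)
    rw [show signedFreq X y (X k j) = 0 from hirr k j hj, zero_div, mul_zero, sub_zero,
      ← abs_mul_label (hy k)] at h1
    exact (abs_le.1 h1).1
  have himpγ : ∀ k, 2 * n * T - 8 * x ≤ y k * inner ℝ (E' (X k (star k))) v := by
    intro k
    have h1 := hγ (X k (star k))
    rw [← abs_mul_label (hy k), mul_sub] at h1
    have h2 := one_div_le_label_mul_signedFreq hy (himp k)
    -- The size `4n²T²` of the step enters here, against signed frequency at least `1/(nT)`.
    have h3 : 2 * (n : ℝ) * T ≤ η / 2 * (y k * signedFreq X y (X k (star k))) := by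
      calc 2 * (n : ℝ) * T = (4 * (n : ℝ) ^ 2 * (T : ℝ) ^ 2) / 2 * (1 / (n * T)) := by
            field_simp; ring
        _ ≤ η / 2 * (1 / (n * T)) := by gcongr
        _ ≤ _ := by gcongr
    linarith [(abs_le.1 h1).1]
  -- The important token has weight at least `(1 - 80x)/T` and value about `2nT`, so the margin is
  -- at least `2n(1 - 80x) - 8x ≥ n` for `x ≤ 1/1000`.
  have hout : ∀ k, (n : ℝ) ≤ y k * output v E' p' (X k) := by
    intro k
    have hw := abs_le.1 (abs_weight_sub_one_le (by linarith) hscore (X k) (star k))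
    have hlow : ∑ i, (weight E' p' (X k) i * (-(8 * x)) +
        if i = star k then weight E' p' (X k) i * (2 * n * T) else 0) ≤
        ∑ i, weight E' p' (X k) i * (y k * inner ℝ (E' (X k i)) v) := by
      refine Finset.sum_le_sum fun i _ => ?_
      have h0 := weight_nonneg E' p' (X k) i
      split_ifs with hi
      · rw [← mul_add]
        refine mul_le_mul_of_nonneg_left ?_ h0
        rw [hi]
        linarith [himpγ k]
      · rw [add_zero]
        exact mul_le_mul_of_nonneg_left (hirrγ k i hi) h0
    rw [Finset.sum_add_distrib, ← Finset.sum_mul, sum_weight _ _ hT,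
      Finset.sum_ite_eq' Finset.univ (star k), if_pos (Finset.mem_univ _)] at hlow
    have heq : y k * output v E' p' (X k) =
        ∑ i, weight E' p' (X k) i * (y k * inner ℝ (E' (X k i)) v) := by
      rw [output_eq, Finset.mul_sum]
      exact Finset.sum_congr rfl fun i _ => by ring
    rw [heq]
    nlinarith [hw.1]
  have hsum : (n : ℝ) * loss X y v E' p' ≤ n * Real.exp (-n) := by
    unfold loss
    rw [one_div, ← mul_assoc, mul_inv_cancel₀ (by positivity), one_mul]
    calc _ ≤ ∑ _k : Fin n, Real.exp (-n) := Finset.sum_le_sum fun k _ => by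
          have h1 := Real.log_le_sub_one_of_pos
            (x := 1 + Real.exp (-(y k * output v E' p' (X k)))) (by positivity)
          have h2 : Real.exp (-(y k * output v E' p' (X k))) ≤ Real.exp (-n) :=
            Real.exp_le_exp.2 (neg_le_neg (hout k))
          linarith
      _ = n * Real.exp (-n) := by simp
  refine hsum.trans ?_
  have h1 : (n : ℝ) ≤ Real.exp (n - 1) := by linarith [Real.add_one_le_exp ((n : ℝ) - 1)]
  calc (n : ℝ) * Real.exp (-n) ≤ Real.exp (n - 1) * Real.exp (-n) := by gcongr
    _ = Real.exp (-1) := by rw [← Real.exp_add]; congr 1; ring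

/-- The important tokens can be separated from the irrelevant ones. -/
theorem exists_separator [Fintype S] (h : NearOrthogonal τ v E p) (hn : 1 ≤ n) (hT : 0 < T)
    (hy : ∀ k, y k = 1 ∨ y k = -1)
    (hη : 16 ≤ η) (hητ : η * τ ≤ 1 / 1000) (hcard : (Fintype.card S : ℝ) * (η * τ) ≤ 1 / 1000)
    {star : Fin n → Fin T} (himp : ∀ k, IsImportant X y (X k (star k)))
    (hirr : ∀ k j, j ≠ star k → IsIrrelevant X y (X k j)) :
    ∃ u : EuclideanSpace ℝ (Fin d), ∀ k j, j ≠ star k →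
      1 ≤ inner ℝ u (stepE X y v η E p (X k (star k)) - stepE X y v η E p (X k j)) := by
  classical
  have hτ0 := (abs_nonneg _).trans h.inner_p_v
  have hτ : τ ≤ 1 / 2 := by nlinarith
  have h5 : 16 * τ ≤ η * τ := by nlinarith
  set J := Finset.univ.filter fun s : S => ¬ IsIrrelevant X y s with hJ
  have hJcard : (J.card : ℝ) ≤ Fintype.card S := by exact_mod_cast Finset.card_le_univ J
  have hne : ∀ t s, t ≠ s → |inner ℝ (E t) (stepE X y v η E p s)| ≤ 3 * (η * τ) := by
    intro t s hts
    have h1 := h.abs_inner_token_stepE_sub_le (X := X) (y := y) hn hT hy hη hτ t s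
    have h2 := h.inner_token_token t s hts
    rw [abs_le] at h1 h2 ⊢
    constructor <;> linarith [h1.1, h1.2, h2.1, h2.2]
  -- Against this sum of initial embeddings an important updated token scores nearly its own squared
  -- norm, at least `1/4`, and an irrelevant one nearly `0`; the factor `8` leaves room for `|S|`
  -- errors of size `3ητ`.
  refine ⟨(8 : ℝ) • ∑ t ∈ J, E t, fun k j hj => ?_⟩
  rw [inner_sub_right, real_inner_smul_left, real_inner_smul_left, sum_inner, sum_inner]
  have hj' : X k j ∉ J := by simpa [hJ] using hirr k j hj
  have hs : X k (star k) ∈ J := by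
    simpa [hJ] using not_isIrrelevant_of_isImportant hy (himp k)
  have h1 : ∑ t ∈ J, inner ℝ (E t) (stepE X y v η E p (X k j)) ≤ J.card * (3 * (η * τ)) := by
    rw [← nsmul_eq_mul]
    refine Finset.sum_le_card_nsmul _ _ _ fun t ht => ?_
    exact (abs_le.1 (hne t _ (by rintro rfl; exact hj' ht))).2
  have h2 : 1 / 4 - 2 * (η * τ) ≤ inner ℝ (E (X k (star k)))
      (stepE X y v η E p (X k (star k))) := by
    have h3 := (abs_le.1 (h.abs_inner_token_stepE_sub_le (X := X) (y := y) hn hT hy hη hτ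
      (X k (star k)) (X k (star k)))).1
    have h4 := h.le_norm_sq_token (X k (star k))
    rw [real_inner_self_eq_norm_sq] at h3
    linarith
  have h3 : 1 / 4 - 2 * (η * τ) - J.card * (3 * (η * τ)) ≤
      ∑ t ∈ J, inner ℝ (E t) (stepE X y v η E p (X k (star k))) := by
    have h4 : (J.erase (X k (star k))).card • (-(3 * (η * τ))) ≤
        ∑ t ∈ J.erase (X k (star k)), inner ℝ (E t) (stepE X y v η E p (X k (star k))) :=
      Finset.card_nsmul_le_sum _ _ _ fun t ht =>
        (abs_le.1 (hne t _ (Finset.ne_of_mem_erase ht))).1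
    rw [← Finset.add_sum_erase _ _ hs]
    have h6 : ((J.erase (X k (star k))).card : ℝ) ≤ J.card := by
      exact_mod_cast Finset.card_le_card (Finset.erase_subset _ _)
    rw [nsmul_eq_mul] at h4
    nlinarith
  nlinarith

end NearOrthogonal

end UpdatedEmbeddings

/-! ### Least-norm solution and identification of the limit -/

section Conclusion

variable {S : Type*} {n T d : ℕ} {X : Fin n → Fin T → S} {y : Fin n → ℝ}
  {v : EuclideanSpace ℝ (Fin d)} {E : S → EuclideanSpace ℝ (Fin d)}

/-- The point of least norm of a nonempty closed convex set exists and is unique. -/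
theorem existsUnique_norm_le {F : Type*} [NormedAddCommGroup F] [InnerProductSpace ℝ F]
    [CompleteSpace F] {K : Set F} (hne : K.Nonempty) (hc : IsClosed K) (hconv : Convex ℝ K) :
    ∃! q, q ∈ K ∧ ∀ x ∈ K, ‖q‖ ≤ ‖x‖ := by
  obtain ⟨q, hq, hmin⟩ := exists_norm_eq_iInf_of_complete_convex hne hc.isComplete hconv 0
  have hiff := norm_eq_iInf_iff_real_inner_le_zero hconv (u := 0) hq
  refine ⟨q, ⟨hq, fun x hx => ?_⟩, ?_⟩
  · have := ciInf_le (f := fun w : K => ‖(0 : F) - w‖) ⟨0, by rintro _ ⟨w, rfl⟩; positivity⟩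
      ⟨x, hx⟩
    rw [← hmin] at this
    simpa using this
  · rintro q' ⟨hq', hmin'⟩
    have h1 := hiff.1 hmin q' hq'
    have h2 := hmin' q hq
    -- The last term is nonpositive by the variational inequality for the projection of `0`, so
    -- equal norms force `q' = q`.
    have h3 : ‖q' - q‖ ^ 2 = ‖q'‖ ^ 2 - ‖q‖ ^ 2 + 2 * inner ℝ (0 - q) (q' - q) := by
      rw [norm_sub_sq_real, zero_sub, inner_neg_left, inner_sub_right, real_inner_self_eq_norm_sq,
        real_inner_comm q]
      ring
    have h4 : ‖q'‖ ^ 2 ≤ ‖q‖ ^ 2 := by gcongr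
    have h5 : ‖q' - q‖ ^ 2 = 0 := le_antisymm (by linarith) (by positivity)
    exact sub_eq_zero.1 (norm_eq_zero.1 (pow_eq_zero_iff (two_ne_zero)|>.1 h5))

theorem existsUnique_isImportantMaxMargin (hne : (importantMarginSet X y E).Nonempty) :
    ∃! q, IsImportantMaxMargin X y E q := by
  refine existsUnique_norm_le hne ?_ ?_
  · simp only [importantMarginSet, Set.ofPred_forall]
    refine isClosed_iInter fun k => isClosed_iInter fun s => isClosed_iInter fun _ =>
      isClosed_iInter fun _ => isClosed_iInter fun s' => isClosed_iInter fun _ => ?_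
    exact isClosed_le continuous_const (by fun_prop)
  · intro a ha b hb r t hr ht hrt k s hs hsi s' hs'
    have h1 := ha k s hs hsi s' hs'
    have h2 := hb k s hs hsi s' hs'
    rw [inner_add_left, real_inner_smul_left, real_inner_smul_left]
    nlinarith

variable [DecidableEq S]

-- No occurring token is both important and irrelevant, so position `star k` alone carries the
-- important token of sequence `k`.
theorem mem_importantMarginSet_iff (hy : ∀ k, y k = 1 ∨ y k = -1) {star : Fin n → Fin T}
    (himp : ∀ k, IsImportant X y (X k (star k)))
    (hirr : ∀ k j, j ≠ star k → IsIrrelevant X y (X k j)) {q : EuclideanSpace ℝ (Fin d)} :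
    q ∈ importantMarginSet X y E ↔
      ∀ k j, j ≠ star k → 1 ≤ inner ℝ q (E (X k (star k)) - E (X k j)) := by
  constructor
  · intro hq k j hj
    refine hq k _ ⟨star k, rfl⟩ (himp k) _ ⟨⟨j, rfl⟩, fun hmem => ?_⟩
    have := hirr k j hj
    rw [Set.mem_singleton_iff.1 hmem] at this
    exact not_isIrrelevant_of_isImportant hy (himp k) this
  · rintro hq k s ⟨i, rfl⟩ hs s' ⟨⟨j, rfl⟩, hj⟩
    have hi : i = star k := by
      by_contra hne
      exact not_isIrrelevant_of_isImportant hy hs (hirr k i hne)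
    subst hi
    exact hq k j fun h => hj (by rw [h]; rfl)

/-- The limit direction of the gradient flow is that of the max-margin solution, and selects only
the important tokens. -/
theorem eq_direction_and_not_isIrrelevant (hn : 1 ≤ n) (hT : 2 ≤ T)
    (hy : ∀ k, y k = 1 ∨ y k = -1) {star : Fin n → Fin T}
    (himp : ∀ k, IsImportant X y (X k (star k)))
    (hirr : ∀ k j, j ≠ star k → IsIrrelevant X y (X k j))
    (hγ : ∀ k j, j ≠ star k → |inner ℝ (E (X k j)) v| ≤ 1 / 4)
    {pInit : EuclideanSpace ℝ (Fin d)} (hL : (n : ℝ) * loss X y v E pInit ≤ Real.exp (-1))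
    {p : ℝ → EuclideanSpace ℝ (Fin d)} (hp : IsGradientFlow X y v E pInit p)
    {q w : EuclideanSpace ℝ (Fin d)} (hq : IsImportantMaxMargin X y E q)
    (hw : Tendsto (fun t => ‖p t‖⁻¹ • p t) atTop (𝓝 w)) :
    w = ‖q‖⁻¹ • q ∧ ∀ k, ∀ s ∈ selected E w (X k), ¬ IsIrrelevant X y s := by
  obtain ⟨hw1, m₀, hm₀, hpos, hle⟩ := direction_of_isGradientFlow hn hT hy hγ hL hp
    ((mem_importantMarginSet_iff hy himp hirr).1 hq.1) hw
  have hmem : m₀⁻¹ • w ∈ importantMarginSet X y E := by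
    rw [mem_importantMarginSet_iff hy himp hirr]
    intro k j hj
    rw [real_inner_smul_left, inv_mul_eq_div, one_le_div hpos]
    exact hm₀ k j hj
  have hnorm : ‖m₀⁻¹ • w‖ = m₀⁻¹ := by
    rw [norm_smul, hw1, mul_one, Real.norm_of_nonneg (by positivity)]
  have hmin : m₀⁻¹ ≤ ‖q‖ := by
    rw [inv_le_iff_one_le_mul₀ hpos, mul_comm]
    have := real_inner_le_norm w q
    rw [hw1, one_mul] at this
    exact hle.trans (mul_le_mul_of_nonneg_left this hpos.le)
  have heq : m₀⁻¹ • w = q := (existsUnique_isImportantMaxMargin ⟨_, hmem⟩).unique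
    ⟨hmem, fun x hx => by rw [hnorm]; exact hmin.trans (hq.2 x hx)⟩ hq
  refine ⟨?_, ?_⟩
  · rw [← heq, hnorm, inv_inv, smul_smul, mul_inv_cancel₀ hpos.ne', one_smul]
  · rintro k s ⟨⟨i, rfl⟩, hs⟩
    have hi : i = star k := by
      by_contra hne
      have h1 := hs _ ⟨star k, rfl⟩
      have h2 := hm₀ k i hne
      rw [inner_sub_right] at h2
      linarith
    rw [hi]
    exact not_isIrrelevant_of_isImportant hy (himp k)

end Conclusion

/-! ### Tail bounds for Gaussian vectors -/

section GaussianTails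

variable {d : ℕ}

instance isProbabilityMeasure_gaussianVec : IsProbabilityMeasure (gaussianVec d) := by
  unfold gaussianVec
  exact Measure.isProbabilityMeasure_map (by fun_prop)

theorem gaussianVec_real_apply {A : Set (EuclideanSpace ℝ (Fin d))} (hA : MeasurableSet A) :
    (gaussianVec d).real A =
      (Measure.pi fun _ : Fin d => gaussianReal 0 ((d : NNReal)⁻¹)).real
        {x | WithLp.toLp 2 x ∈ A} := by
  unfold gaussianVec
  rw [map_measureReal_apply (by fun_prop) hA]
  rfl

theorem hasSubgaussianMGF_gaussianReal (v : NNReal) :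
    HasSubgaussianMGF (fun x => x) v (gaussianReal 0 v) where
  integrable_exp_mul t := integrable_exp_mul_gaussianReal t
  mgf_le t := by rw [mgf_fun_id_gaussianReal]; simp

/-- The inner product is a sum of independent sub-Gaussian coordinates with total variance proxy
`‖u‖²/d ≤ 4/d`. -/
theorem gaussianVec_real_lt_inner_le (hd : 0 < d) {u : EuclideanSpace ℝ (Fin d)}
    (hu : ‖u‖ ^ 2 ≤ 4) {τ : ℝ} (hτ : 0 ≤ τ) :
    (gaussianVec d).real {x | τ ≤ inner ℝ x u} ≤ Real.exp (-(d * τ ^ 2 / 8)) := by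
  set μ := Measure.pi fun _ : Fin d => gaussianReal 0 ((d : NNReal)⁻¹) with hμ
  have hd' : (0 : ℝ) < d := by exact_mod_cast hd
  have hone : ∀ i : Fin d, HasSubgaussianMGF (fun x : Fin d → ℝ => u i * x i)
      (‖u i‖₊ ^ 2 * (d : NNReal)⁻¹) μ := fun i => by
    have h1 := hasSubgaussianMGF_gaussianReal ((d : NNReal)⁻¹)
    rw [← (measurePreserving_eval (fun _ : Fin d => gaussianReal 0 ((d : NNReal)⁻¹)) i).map_eq]
      at h1
    have h2 := (HasSubgaussianMGF.of_map (μ := μ) (Y := Function.eval i) (X := fun x => x)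
      (measurable_pi_apply i).aemeasurable h1).const_mul (u i)
    refine ⟨h2.integrable_exp_mul, fun t => (h2.mgf_le t).trans_eq ?_⟩
    change Real.exp (u i ^ 2 * (((d : NNReal)⁻¹ : NNReal) : ℝ) * t ^ 2 / 2) = _
    rw [NNReal.coe_mul, NNReal.coe_pow, coe_nnnorm, Real.norm_eq_abs, sq_abs]
  have hind : iIndepFun (fun (i : Fin d) (x : Fin d → ℝ) => u i * x i) μ :=
    iIndepFun_pi (X := fun i (r : ℝ) => u i * r) fun i => by fun_prop
  have hsum := HasSubgaussianMGF.sum_of_iIndepFun (s := Finset.univ) hind fun i _ => hone i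
  have hc : ((∑ i : Fin d, ‖u i‖₊ ^ 2 * (d : NNReal)⁻¹ : NNReal) : ℝ) ≤
      ((4 / d : NNReal) : ℝ) := by
    rw [← Finset.sum_mul]
    push_cast
    rw [← div_eq_mul_inv, ← EuclideanSpace.norm_sq_eq]
    gcongr
  have hsub : HasSubgaussianMGF (fun x : Fin d → ℝ => ∑ i, u i * x i) (4 / d) μ :=
    ⟨hsum.integrable_exp_mul, fun t => (hsum.mgf_le t).trans (by gcongr)⟩
  rw [gaussianVec_real_apply (measurableSet_le (by fun_prop) (by fun_prop))]
  have h3 : {x : Fin d → ℝ | WithLp.toLp 2 x ∈ {x : EuclideanSpace ℝ (Fin d) | τ ≤ inner ℝ x u}} =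
      {x | τ ≤ ∑ i, u i * x i} := by
    ext x
    simp [PiLp.inner_apply]
  rw [h3]
  refine (hsub.measure_ge_le hτ).trans_eq ?_
  congr 1
  push_cast
  field_simp
  ring

theorem integral_exp_mul_sq_gaussianReal {v : NNReal} (hv : v ≠ 0) {t : ℝ}
    (ht : 2 * t * v < 1) :
    Integrable (fun x => Real.exp (t * x ^ 2)) (gaussianReal 0 v) ∧
      mgf (fun x => x ^ 2) (gaussianReal 0 v) t = (√(1 - 2 * t * v))⁻¹ := by
  have hv' : (0 : ℝ) < v := by positivity
  have hb : 0 < 1 / (2 * (v : ℝ)) - t := by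
    rw [sub_pos, lt_div_iff₀ (by positivity)]; linarith
  have hm : mgf (fun x => x ^ 2) (gaussianReal 0 v) t = (√(1 - 2 * t * v))⁻¹ := by
    unfold mgf
    rw [integral_gaussianReal_eq_integral_smul hv]
    have h1 : ∀ x : ℝ, gaussianPDFReal 0 v x • Real.exp (t * x ^ 2) =
        (√(2 * Real.pi * v))⁻¹ * Real.exp (-(1 / (2 * (v : ℝ)) - t) * x ^ 2) := fun x => by
      rw [gaussianPDFReal, smul_eq_mul, mul_assoc, ← Real.exp_add]
      congr 2
      field_simp
      ring
    simp only [h1]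
    rw [integral_const_mul, integral_gaussian, ← Real.sqrt_inv, ← Real.sqrt_inv,
      ← Real.sqrt_mul (by positivity)]
    congr 1
    have : 1 - 2 * t * v ≠ 0 := by linarith
    field_simp
  refine ⟨?_, hm⟩
  -- Integrability follows from the computed value: a non-integrable exponential would have `mgf`
  -- equal to the default `0`.
  rw [← mgf_pos_iff, hm]
  have : 0 < 1 - 2 * t * v := by linarith
  positivity

theorem mgf_norm_sq_gaussianVec (hd : 0 < d) {t : ℝ} (ht : 2 * t * (d : ℝ)⁻¹ < 1) :
    Integrable (fun x => Real.exp (t * ‖x‖ ^ 2)) (gaussianVec d) ∧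
      mgf (fun x => ‖x‖ ^ 2) (gaussianVec d) t = (√(1 - 2 * t * (d : ℝ)⁻¹))⁻¹ ^ d := by
  set μ := Measure.pi fun _ : Fin d => gaussianReal 0 ((d : NNReal)⁻¹) with hμ
  have hd' : (0 : ℝ) < d := by exact_mod_cast hd
  obtain ⟨-, h2⟩ := integral_exp_mul_sq_gaussianReal (v := (d : NNReal)⁻¹) (t := t)
    (by positivity) (by simpa using ht)
  have hind : iIndepFun (fun (i : Fin d) (x : Fin d → ℝ) => x i ^ 2) μ :=
    iIndepFun_pi (X := fun _ (r : ℝ) => r ^ 2) fun i => by fun_prop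
  have h3 := hind.mgf_sum (t := t) (fun i => by fun_prop) Finset.univ
  have h4 : ∀ i : Fin d, mgf (fun x : Fin d → ℝ => x i ^ 2) μ t =
      (√(1 - 2 * t * (d : ℝ)⁻¹))⁻¹ := fun i => by
    have h5 := mgf_map (μ := μ) (Y := fun x : Fin d → ℝ => x i) (X := fun r : ℝ => r ^ 2) (t := t)
      (measurable_pi_apply i).aemeasurable (by fun_prop)
    rw [(measurePreserving_eval (fun _ : Fin d => gaussianReal 0 ((d : NNReal)⁻¹)) i).map_eq,
      h2] at h5
    rw [show (fun x : Fin d → ℝ => x i ^ 2) = (fun r : ℝ => r ^ 2) ∘ fun x : Fin d → ℝ => x i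
      from rfl, ← h5]
    simp
  have hm : mgf (fun x => ‖x‖ ^ 2) (gaussianVec d) t = (√(1 - 2 * t * (d : ℝ)⁻¹))⁻¹ ^ d := by
    unfold gaussianVec
    rw [mgf_map (by fun_prop) (by fun_prop)]
    rw [show (fun x : EuclideanSpace ℝ (Fin d) => ‖x‖ ^ 2) ∘ WithLp.toLp 2 =
      ∑ i : Fin d, fun x : Fin d → ℝ => x i ^ 2 from by
        ext x; simp [EuclideanSpace.norm_sq_eq], h3]
    simp [h4]
  refine ⟨?_, hm⟩
  rw [← mgf_pos_iff, hm]
  have : 0 < 1 - 2 * t * (d : ℝ)⁻¹ := by linarith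
  positivity

/-- Chernoff at `t = d/4` gives `e^(-d) 2^(d/2)`, and `2 ≤ e`. -/
theorem gaussianVec_real_le_norm_sq_le (hd : 0 < d) :
    (gaussianVec d).real {x | 4 ≤ ‖x‖ ^ 2} ≤ Real.exp (-(d / 8)) := by
  have hd' : (0 : ℝ) < d := by exact_mod_cast hd
  have ht : 2 * ((d : ℝ) / 4) * (d : ℝ)⁻¹ = 1 / 2 := by field_simp; norm_num
  obtain ⟨h1, h2⟩ := mgf_norm_sq_gaussianVec hd (t := (d : ℝ) / 4) (by rw [ht]; norm_num)
  have h3 := measure_ge_le_exp_mul_mgf (μ := gaussianVec d) (X := fun x => ‖x‖ ^ 2) 4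
    (by positivity) h1
  refine h3.trans ?_
  have h4 : (√(1 - 1 / 2))⁻¹ ≤ Real.exp (1 / 2 : ℝ) := by
    rw [← Real.sqrt_inv, Real.sqrt_le_left (Real.exp_pos _).le, ← Real.exp_nat_mul]
    have := Real.exp_one_gt_d9
    norm_num at this ⊢
    linarith
  rw [h2, ht]
  calc _ ≤ Real.exp (-((d : ℝ) / 4) * 4) * Real.exp (1 / 2 : ℝ) ^ d := by gcongr
    _ = Real.exp (-((d : ℝ) / 4) * 4 + d * (1 / 2)) := by rw [← Real.exp_nat_mul, Real.exp_add]
    _ ≤ _ := Real.exp_le_exp.2 (by linarith)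

/-- Chernoff at `t = -d/2` gives `e^(d/8) 2^(-d/2)`, and `2 ≥ e^(1/2)`. -/
theorem gaussianVec_real_norm_sq_le_le (hd : 0 < d) :
    (gaussianVec d).real {x | ‖x‖ ^ 2 ≤ 1 / 4} ≤ Real.exp (-(d / 8)) := by
  have hd' : (0 : ℝ) < d := by exact_mod_cast hd
  have ht : 2 * (-(d : ℝ) / 2) * (d : ℝ)⁻¹ = -1 := by field_simp
  obtain ⟨h1, h2⟩ := mgf_norm_sq_gaussianVec hd (t := -(d : ℝ) / 2) (by rw [ht]; norm_num)
  have h3 := measure_le_le_exp_mul_mgf (μ := gaussianVec d) (X := fun x => ‖x‖ ^ 2) (1 / 4)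
    (by linarith) h1
  refine h3.trans ?_
  have h4 : (√(1 - -1))⁻¹ ≤ Real.exp (-(1 / 4) : ℝ) := by
    rw [Real.exp_neg]
    gcongr
    rw [Real.le_sqrt' (Real.exp_pos _), ← Real.exp_nat_mul]
    have h5 : Real.exp ((2 : ℕ) * (1 / 4)) = √(Real.exp 1) := by
      rw [← Real.exp_half]; congr 1; norm_num
    rw [h5, Real.sqrt_le_left (by norm_num)]
    have := Real.exp_one_lt_three
    linarith
  rw [h2, ht]
  calc _ ≤ Real.exp (-(-(d : ℝ) / 2) * (1 / 4)) * Real.exp (-(1 / 4) : ℝ) ^ d := by gcongr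
    _ = Real.exp (-(-(d : ℝ) / 2) * (1 / 4) + d * -(1 / 4)) := by
        rw [← Real.exp_nat_mul, Real.exp_add]
    _ ≤ _ := Real.exp_le_exp.2 (by linarith)

end GaussianTails

/-! ### Near-orthogonality with high probability -/

section UnionBound

variable {S : Type*} {d : ℕ}

/-- Both squared norm and component along `v` of `x` are within the range of a typical Gaussian
vector. -/
def IsTypical (τ : ℝ) (v x : EuclideanSpace ℝ (Fin d)) : Prop :=
  |inner ℝ x v| ≤ τ ∧ 1 / 4 ≤ ‖x‖ ^ 2 ∧ ‖x‖ ^ 2 ≤ 4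

theorem gaussianVec_lt_abs_inner_le (hd : 0 < d) {u : EuclideanSpace ℝ (Fin d)}
    (hu : ‖u‖ ^ 2 ≤ 4) {τ : ℝ} (hτ : 0 ≤ τ) :
    gaussianVec d {x | τ < |inner ℝ x u|} ≤ ENNReal.ofReal (2 * Real.exp (-(d * τ ^ 2 / 8))) := by
  have h1 := gaussianVec_real_lt_inner_le hd hu hτ
  have h2 := gaussianVec_real_lt_inner_le hd (u := -u) (by rwa [norm_neg]) hτ
  have hsub : {x : EuclideanSpace ℝ (Fin d) | τ < |inner ℝ x u|} ⊆
      {x | τ ≤ inner ℝ x u} ∪ {x | τ ≤ inner ℝ x (-u)} := by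
    intro x hx
    rcases lt_abs.1 (show τ < |inner ℝ x u| from hx) with h | h
    · exact Or.inl h.le
    · right
      simp only [Set.mem_ofPred_eq, inner_neg_right]
      exact h.le
  rw [← ofReal_measureReal]
  refine ENNReal.ofReal_le_ofReal ?_
  calc _ ≤ _ := measureReal_mono hsub
    _ ≤ _ := measureReal_union_le _ _
    _ ≤ _ := by linarith

theorem gaussianVec_not_isTypical_le (hd : 0 < d) {v : EuclideanSpace ℝ (Fin d)}
    (hv : ‖v‖ = 1) {τ : ℝ} (hτ : 0 ≤ τ) :
    gaussianVec d {x | ¬ IsTypical τ v x} ≤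
      ENNReal.ofReal (2 * Real.exp (-(d * τ ^ 2 / 8)) + 2 * Real.exp (-(d / 8))) := by
  have h1 := gaussianVec_lt_abs_inner_le hd (u := v) (by rw [hv]; norm_num) hτ
  have h2 := ENNReal.ofReal_le_ofReal (gaussianVec_real_le_norm_sq_le hd)
  have h3 := ENNReal.ofReal_le_ofReal (gaussianVec_real_norm_sq_le_le hd)
  rw [ofReal_measureReal] at h2 h3
  have hsub : {x | ¬ IsTypical τ v x} ⊆ {x | τ < |inner ℝ x v|} ∪
      ({x | 4 ≤ ‖x‖ ^ 2} ∪ {x | ‖x‖ ^ 2 ≤ 1 / 4}) := by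
    intro x hx
    by_contra hcon
    simp only [Set.mem_union, Set.mem_ofPred_eq, not_or, not_lt, not_le] at hcon
    exact hx ⟨hcon.1, hcon.2.2.le, hcon.2.1.le⟩
  calc _ ≤ _ := measure_mono hsub
    _ ≤ _ := (measure_union_le _ _).trans (add_le_add le_rfl (measure_union_le _ _))
    _ ≤ _ := add_le_add h1 (add_le_add h2 h3)
    _ = _ := by
      rw [← ENNReal.ofReal_add (by positivity) (by positivity),
        ← ENNReal.ofReal_add (by positivity) (by positivity), two_mul (Real.exp (-((d : ℝ) / 8)))]

/-- Conditionally on the first vector this is the one-vector tail, unless its squared norm is at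
least `4`, which is itself rare. -/
theorem gaussianVec_prod_lt_abs_inner_le (hd : 0 < d) {τ : ℝ} (hτ : 0 ≤ τ) :
    ((gaussianVec d).prod (gaussianVec d)) {z | τ < |inner ℝ z.1 z.2|} ≤
      ENNReal.ofReal (2 * Real.exp (-(d * τ ^ 2 / 8)) + 2 * Real.exp (-(d / 8))) := by
  have hmeas : MeasurableSet {z : EuclideanSpace ℝ (Fin d) × EuclideanSpace ℝ (Fin d) |
      τ < |inner ℝ z.1 z.2|} :=
    measurableSet_lt measurable_const (by fun_prop)
  have hA : MeasurableSet {x : EuclideanSpace ℝ (Fin d) | 4 ≤ ‖x‖ ^ 2} :=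
    measurableSet_le measurable_const (by fun_prop)
  have h2 := ENNReal.ofReal_le_ofReal (gaussianVec_real_le_norm_sq_le hd)
  rw [ofReal_measureReal] at h2
  rw [Measure.prod_apply hmeas]
  calc _ ≤ ∫⁻ x, ({x : EuclideanSpace ℝ (Fin d) | 4 ≤ ‖x‖ ^ 2}.indicator 1 x +
          ENNReal.ofReal (2 * Real.exp (-(d * τ ^ 2 / 8)))) ∂(gaussianVec d) := by
        refine lintegral_mono fun x => ?_
        by_cases hx : 4 ≤ ‖x‖ ^ 2
        · rw [Set.indicator_of_mem (show x ∈ {x | 4 ≤ ‖x‖ ^ 2} from hx)]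
          exact prob_le_one.trans le_self_add
        · refine le_trans ?_ le_add_self
          refine le_trans (measure_mono ?_)
            (gaussianVec_lt_abs_inner_le hd (u := x) (not_le.1 hx).le hτ)
          intro z hz
          simpa [real_inner_comm] using hz
    _ = gaussianVec d {x | 4 ≤ ‖x‖ ^ 2} +
          ENNReal.ofReal (2 * Real.exp (-(d * τ ^ 2 / 8))) := by
        rw [lintegral_add_right _ measurable_const, lintegral_indicator_one hA, lintegral_const,
          measure_univ, mul_one]
    _ ≤ _ := by
        refine (add_le_add h2 le_rfl).trans ?_
        rw [← ENNReal.ofReal_add (by positivity) (by positivity)]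
        refine ENNReal.ofReal_le_ofReal ?_
        have := Real.exp_pos (-((d : ℝ) / 8))
        linarith

variable [Fintype S]

instance isProbabilityMeasure_initLaw : IsProbabilityMeasure (initLaw S d) := by
  unfold initLaw
  infer_instance

/-- The initial embeddings as one family, with `none` the classification token. -/
def initVec (ω : (S → EuclideanSpace ℝ (Fin d)) × EuclideanSpace ℝ (Fin d)) :
    Option S → EuclideanSpace ℝ (Fin d)
  | none => ω.2
  | some s => ω.1 s

theorem measurePreserving_initVec (a : Option S) :
    MeasurePreserving (fun ω => initVec ω a) (initLaw S d) (gaussianVec d) := by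
  cases a with
  | none => exact measurePreserving_snd
  | some s => exact (measurePreserving_eval (fun _ : S => gaussianVec d) s).comp measurePreserving_fst

theorem measurePreserving_initVec_pair {a b : Option S} (hab : a ≠ b) :
    MeasurePreserving (fun ω => (initVec ω a, initVec ω b)) (initLaw S d)
      ((gaussianVec d).prod (gaussianVec d)) := by
  have hsome : ∀ s, MeasurePreserving (fun ω => (initVec ω (some s), initVec ω none))
      (initLaw S d) ((gaussianVec d).prod (gaussianVec d)) := fun s =>
    (measurePreserving_eval (fun _ : S => gaussianVec d) s).prod
      (MeasurePreserving.id (gaussianVec d))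
  match a, b with
  | none, none => exact absurd rfl hab
  | some s, none => exact hsome s
  | none, some s => exact Measure.measurePreserving_swap.comp (hsome s)
  | some s, some s' =>
    have hne : s ≠ s' := fun h => hab (by rw [h])
    have hind : iIndepFun (fun (s : S) (ω : S → EuclideanSpace ℝ (Fin d)) => ω s)
        (Measure.pi fun _ : S => gaussianVec d) :=
      iIndepFun_pi (X := fun _ x => x) fun _ => aemeasurable_id
    have hmap := (indepFun_iff_map_prod_eq_prod_map_map
      (measurable_pi_apply s).aemeasurable (measurable_pi_apply s').aemeasurable).1
      (hind.indepFun hne)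
    have he : ∀ s : S, (Measure.pi fun _ : S => gaussianVec d).map (fun ω => ω s) =
        gaussianVec d := fun s =>
      (measurePreserving_eval (fun _ : S => gaussianVec d) s).map_eq
    rw [he, he] at hmap
    have hpres : MeasurePreserving (fun ω : S → EuclideanSpace ℝ (Fin d) => (ω s, ω s'))
        (Measure.pi fun _ : S => gaussianVec d) ((gaussianVec d).prod (gaussianVec d)) :=
      ⟨by fun_prop, hmap⟩
    exact hpres.comp measurePreserving_fst

theorem measurableSet_nearOrthogonal (τ : ℝ) (v : EuclideanSpace ℝ (Fin d)) :
    MeasurableSet {ω : (S → EuclideanSpace ℝ (Fin d)) × EuclideanSpace ℝ (Fin d) |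
      NearOrthogonal τ v ω.1 ω.2} := by
  have hset : {ω : (S → EuclideanSpace ℝ (Fin d)) × EuclideanSpace ℝ (Fin d) |
      NearOrthogonal τ v ω.1 ω.2} =
      {ω | (∀ s, |inner ℝ (ω.1 s) v| ≤ τ) ∧ |inner ℝ ω.2 v| ≤ τ ∧
        (∀ s, |inner ℝ ω.2 (ω.1 s)| ≤ τ) ∧
        (∀ s s', s ≠ s' → |inner ℝ (ω.1 s) (ω.1 s')| ≤ τ) ∧ (∀ s, 1 / 4 ≤ ‖ω.1 s‖ ^ 2) ∧
        (∀ s, ‖ω.1 s‖ ^ 2 ≤ 4) ∧ ‖ω.2‖ ^ 2 ≤ 4} := by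
    ext ω
    exact ⟨fun h => ⟨h.1, h.2, h.3, h.4, h.5, h.6, h.7⟩,
      fun ⟨h1, h2, h3, h4, h5, h6, h7⟩ => ⟨h1, h2, h3, h4, h5, h6, h7⟩⟩
  rw [hset]
  refine IsClosed.measurableSet ?_
  simp only [Set.ofPred_and, Set.ofPred_forall]
  refine IsClosed.inter (isClosed_iInter fun s => isClosed_le (by fun_prop) (by fun_prop)) ?_
  refine IsClosed.inter (isClosed_le (by fun_prop) (by fun_prop)) ?_
  refine IsClosed.inter (isClosed_iInter fun s => isClosed_le (by fun_prop) (by fun_prop)) ?_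
  refine IsClosed.inter (isClosed_iInter fun s => isClosed_iInter fun s' => isClosed_iInter fun _ =>
    isClosed_le (by fun_prop) (by fun_prop)) ?_
  refine IsClosed.inter (isClosed_iInter fun s => isClosed_le (by fun_prop) (by fun_prop)) ?_
  refine IsClosed.inter (isClosed_iInter fun s => isClosed_le (by fun_prop) (by fun_prop)) ?_
  exact isClosed_le (by fun_prop) (by fun_prop)

theorem initLaw_compl_nearOrthogonal_le (hd : 0 < d) {v : EuclideanSpace ℝ (Fin d)}
    (hv : ‖v‖ = 1) {τ : ℝ} (hτ : 0 ≤ τ) :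
    initLaw S d {ω | NearOrthogonal τ v ω.1 ω.2}ᶜ ≤
      ENNReal.ofReal (((Fintype.card S : ℝ) + 1) ^ 2 *
        (2 * Real.exp (-(d * τ ^ 2 / 8)) + 2 * Real.exp (-(d / 8)))) := by
  classical
  set b : ℝ := 2 * Real.exp (-(d * τ ^ 2 / 8)) + 2 * Real.exp (-(d / 8)) with hb
  -- One bad event per ordered pair: diagonal pairs record atypical vectors, the others large inner
  -- products, all with the same bound `b`.
  let B : Option S × Option S →
      Set ((S → EuclideanSpace ℝ (Fin d)) × EuclideanSpace ℝ (Fin d)) := fun ab =>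
    if ab.1 = ab.2 then {ω | ¬ IsTypical τ v (initVec ω ab.1)}
    else {ω | τ < |inner ℝ (initVec ω ab.1) (initVec ω ab.2)|}
  have hB : ∀ ab, initLaw S d (B ab) ≤ ENNReal.ofReal b := by
    rintro ⟨a, a'⟩
    simp only [B]
    split_ifs with h
    · refine le_trans (le_of_eq ?_) (gaussianVec_not_isTypical_le hd hv hτ)
      refine (measurePreserving_initVec a).measure_preimage (s := {x | ¬ IsTypical τ v x}) ?_
      refine MeasurableSet.nullMeasurableSet (MeasurableSet.compl (s := {x | IsTypical τ v x}) ?_)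
      have h1 : MeasurableSet {x : EuclideanSpace ℝ (Fin d) | |inner ℝ x v| ≤ τ} :=
        measurableSet_le (by fun_prop) measurable_const
      have h2 : MeasurableSet {x : EuclideanSpace ℝ (Fin d) | 1 / 4 ≤ ‖x‖ ^ 2} :=
        measurableSet_le measurable_const (by fun_prop)
      have h3 : MeasurableSet {x : EuclideanSpace ℝ (Fin d) | ‖x‖ ^ 2 ≤ 4} :=
        measurableSet_le (by fun_prop) measurable_const
      exact h1.inter (h2.inter h3)
    · refine le_trans (le_of_eq ?_) (gaussianVec_prod_lt_abs_inner_le hd hτ)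
      refine (measurePreserving_initVec_pair h).measure_preimage
        (s := {z | τ < |inner ℝ z.1 z.2|}) ?_
      exact (measurableSet_lt measurable_const (by fun_prop)).nullMeasurableSet
  have hsub : {ω : (S → EuclideanSpace ℝ (Fin d)) × EuclideanSpace ℝ (Fin d) |
      NearOrthogonal τ v ω.1 ω.2}ᶜ ⊆ ⋃ ab, B ab := by
    intro ω hω
    by_contra hcon
    simp only [Set.mem_iUnion, not_exists] at hcon
    have hdiag : ∀ a, IsTypical τ v (initVec ω a) := fun a => by
      simpa [B] using hcon (a, a)
    have hoff : ∀ a a', a ≠ a' → |inner ℝ (initVec ω a) (initVec ω a')| ≤ τ := fun a a' h => by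
      simpa [B, h] using hcon (a, a')
    exact hω
      { inner_token_v := fun s => (hdiag (some s)).1
        inner_p_v := (hdiag none).1
        inner_p_token := fun s => hoff none (some s) (by simp)
        inner_token_token := fun s s' h => hoff (some s) (some s') (by simpa using h)
        le_norm_sq_token := fun s => (hdiag (some s)).2.1
        norm_sq_token_le := fun s => (hdiag (some s)).2.2
        norm_sq_p_le := (hdiag none).2.2 }
  calc _ ≤ initLaw S d (⋃ ab, B ab) := measure_mono hsub
    _ ≤ ∑ ab, initLaw S d (B ab) := measure_iUnion_fintype_le _ _
    _ ≤ ∑ _ab : Option S × Option S, ENNReal.ofReal b := Finset.sum_le_sum fun ab _ => hB ab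
    _ = _ := by
      rw [Finset.sum_const, nsmul_eq_mul, ENNReal.ofReal_mul (by positivity), Finset.card_univ,
        Fintype.card_prod, Fintype.card_option]
      congr 1
      rw [← ENNReal.ofReal_natCast]
      congr 1
      push_cast
      ring

end UnionBound

/-! ### Numerical consequences of the dimension bound -/

section Dimension

/-- In high dimension the probability of an atypical initialization is below the confidence
level. -/
theorem failure_probability_le {N D δ τ : ℝ} (hN : 1 ≤ N) (hδ : 0 < δ)
    (hτ : τ = 3 / √√D) (hD : 15360 ≤ √D) (hlog : (2 * Real.log (N ^ 2 / δ)) ^ 2 ≤ D)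
    (hND : N + 3 ≤ D) :
    (N + 1) ^ 2 * (2 * Real.exp (-(D * τ ^ 2 / 8)) + 2 * Real.exp (-(D / 8))) ≤ δ := by
  set r := √D with hr
  have hD0 : 0 ≤ D := by linarith
  have hr2 : r ^ 2 = D := Real.sq_sqrt hD0
  have hr0 : 0 < r := by linarith
  have hτ2 : τ ^ 2 = 9 / r := by
    rw [hτ, div_pow, Real.sq_sqrt hr0.le]
    norm_num
  have h1 : Real.exp (-(D * τ ^ 2 / 8)) ≤ Real.exp (-r) := by
    refine Real.exp_le_exp.2 (neg_le_neg ?_)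
    rw [hτ2, ← hr2]
    field_simp
    linarith
  have h2 : Real.exp (-(D / 8)) ≤ Real.exp (-r) := by
    refine Real.exp_le_exp.2 (neg_le_neg ?_)
    rw [← hr2]
    nlinarith
  have h3 : Real.exp (-(r / 2)) ≤ δ := by
    have h4 : Real.log (N ^ 2 / δ) ≤ r / 2 := by
      have := Real.abs_le_sqrt hlog
      linarith [le_abs_self (2 * Real.log (N ^ 2 / δ))]
    have h5 : N ^ 2 / δ ≤ Real.exp (r / 2) := (Real.log_le_iff_le_exp (by positivity)).1 h4
    rw [div_le_iff₀ hδ] at h5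
    rw [Real.exp_neg, inv_le_iff_one_le_mul₀ (Real.exp_pos _), mul_comm]
    nlinarith
  -- The fifth Taylor term is `r⁵/3840`, and `15360 = 4 · 3840`.
  have h6 : 4 * r ^ 4 ≤ Real.exp (r / 2) := by
    refine le_trans ?_ (Real.pow_div_factorial_le_exp (r / 2) (by positivity) 5)
    have : Nat.factorial 5 = 120 := rfl
    rw [this]
    have h7 : 0 ≤ r ^ 4 * (r - 15360) := mul_nonneg (by positivity) (by linarith)
    push_cast
    linarith
  have h8 : (N + 1) ^ 2 ≤ r ^ 4 := by
    calc (N + 1) ^ 2 ≤ D ^ 2 := by gcongr; linarith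
      _ = r ^ 4 := by rw [← hr2]; ring
  calc _ ≤ r ^ 4 * (2 * Real.exp (-r) + 2 * Real.exp (-r)) := by gcongr
    _ = 4 * r ^ 4 * Real.exp (-r) := by ring
    _ ≤ Real.exp (r / 2) * Real.exp (-r) := by gcongr
    _ = Real.exp (-(r / 2)) := by rw [← Real.exp_add]; congr 1; ring
    _ ≤ δ := h3

/-- In high dimension one gradient step perturbs inner products only slightly. -/
theorem step_mul_tolerance_le {η D τ : ℝ} (hη : 16 ≤ η)
    (hD : (88 * η ^ 2 + 111 * η + 2) ^ 8 ≤ D) (hτ : τ = 3 / √√D) :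
    15360 ≤ √D ∧ η * τ ≤ 1 / 1000 ∧ η * (η * τ) ≤ 1 / 1000 := by
  set A := 88 * η ^ 2 + 111 * η + 2 with hA
  have hA0 : 22528 ≤ A := by nlinarith
  have h4 : A ^ 4 ≤ √D := Real.le_sqrt_of_sq_le (by rw [← pow_mul]; exact hD)
  have h2 : A ^ 2 ≤ √√D := Real.le_sqrt_of_sq_le (by rw [← pow_mul]; exact h4)
  have hA1 : A ≤ A ^ 4 := le_self_pow₀ (by linarith) (by norm_num)
  have hA2 : 3000 * η ^ 2 ≤ A ^ 2 := by nlinarith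
  have hpos : 0 < √√D := by nlinarith
  refine ⟨by linarith, ?_, ?_⟩
  · rw [hτ, mul_div_assoc', div_le_iff₀ hpos]
    nlinarith
  · rw [hτ, ← mul_assoc, mul_div_assoc', div_le_iff₀ hpos]
    nlinarith

end Dimension

end AttnSelect

/-! ### Assembly of the main theorem -/

theorem lemma4 {S : Type*} [Fintype S] [DecidableEq S] (n T d : ℕ) (hn : 1 ≤ n) (hT : 2 ≤ T)
    (X : Fin n → Fin T → S) (y : Fin n → ℝ) (hy : ∀ k, y k = 1 ∨ y k = -1)
    (hS : ∀ s, ∃ k i, X k i = s)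
    (hX : AttnSelect.SingleImportantToken X y)
    (v : EuclideanSpace ℝ (Fin d)) (hv : ‖v‖ = 1)
    (δ η₀ μ : ℝ) (hδ : 0 < δ) (hμ : 0 < μ)
    (hη : 4 * (n : ℝ) ^ 2 * (T : ℝ) ^ 2 ≤ η₀)
    (hd1 : (256 : ℝ) ≤ d)
    (hd2 : (2 * Real.log ((Fintype.card S : ℝ) ^ 2 / δ)) ^ 2 ≤ d)
    (hd3 : (88 * η₀ ^ 2 + 111 * η₀ + 2) ^ 8 ≤ d)
    (hd4 : (Fintype.card S : ℝ) + 3 ≤ d)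
    (hd5 : (2816 * (T : ℝ) * (n : ℝ) ^ 2 * (1 + 2 * η₀) / μ) ^ 4 ≤ d)
    (hd6 : (2 * η₀ * ((n : ℝ) * Real.sqrt (2 * Real.log ((Fintype.card S : ℝ) ^ 2 / δ))
      + 44 * (n : ℝ))) ^ 4 ≤ d) :
    ∃ G : Set ((S → EuclideanSpace ℝ (Fin d)) × EuclideanSpace ℝ (Fin d)),
      MeasurableSet G ∧ ENNReal.ofReal (1 - δ) ≤ AttnSelect.initLaw S d G ∧
      ∀ E₀ p₀, (E₀, p₀) ∈ G →
        -- existence and uniqueness of the max-margin solution for the important tokens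
        (∃! phat, AttnSelect.IsImportantMaxMargin X y
          (AttnSelect.stepE X y v η₀ E₀ p₀) phat) ∧
        ∀ phat, AttnSelect.IsImportantMaxMargin X y
            (AttnSelect.stepE X y v η₀ E₀ p₀) phat →
          ∀ p : ℝ → EuclideanSpace ℝ (Fin d),
          AttnSelect.IsGradientFlow X y v (AttnSelect.stepE X y v η₀ E₀ p₀)
            (AttnSelect.stepP X y v η₀ E₀ p₀) p →
          ∀ pinf : EuclideanSpace ℝ (Fin d),
          Filter.Tendsto (fun t => ‖p t‖⁻¹ • p t) Filter.atTop (nhds pinf) →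
          -- max-margin solutions with a different selection that point in the direction `pinf`
          (∀ q q', AttnSelect.IsMaxMargin X (AttnSelect.stepE X y v η₀ E₀ p₀) q q' →
            ¬ AttnSelect.SameSelection X (AttnSelect.stepE X y v η₀ E₀ p₀) q phat →
            pinf = ‖q'‖⁻¹ • q' → ‖phat‖ < (1 - μ) * ‖q'‖) →
          pinf = ‖phat‖⁻¹ • phat ∧
          ∀ k, ∀ s ∈ AttnSelect.selected (AttnSelect.stepE X y v η₀ E₀ p₀) pinf (X k),
            ¬ AttnSelect.IsIrrelevant X y s := by

  classical
  choose star himp hirr using hX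
  have hT0 : 0 < T := by omega
  have hn' : (1 : ℝ) ≤ n := by exact_mod_cast hn
  have hT' : (2 : ℝ) ≤ T := by exact_mod_cast hT
  have hd0 : 0 < d := by
    have : (0 : ℝ) < d := by linarith
    exact_mod_cast this
  have hη16 : 16 ≤ η₀ := by
    refine le_trans ?_ hη
    calc (16 : ℝ) = 4 * 1 ^ 2 * 2 ^ 2 := by norm_num
      _ ≤ _ := by gcongr
  have hcard1 : (1 : ℝ) ≤ Fintype.card S := by
    exact_mod_cast Fintype.card_pos_iff.2 ⟨X ⟨0, hn⟩ ⟨0, hT0⟩⟩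
  -- Every token occurs, so `|S| ≤ nT ≤ η₀`; this turns the `|S|` error terms of the separator into
  -- `η₀ (η₀ τ)`.
  have hcardη : (Fintype.card S : ℝ) ≤ η₀ := by
    have h1 : Fintype.card S ≤ n * T := by
      have := Fintype.card_le_of_surjective (fun m : Fin n × Fin T => X m.1 m.2) fun s => by
        obtain ⟨k, i, h⟩ := hS s
        exact ⟨(k, i), h⟩
      simpa using this
    have h2 : (Fintype.card S : ℝ) ≤ n * T := by exact_mod_cast h1
    have h3 : (1 : ℝ) ≤ n * T := by nlinarith
    nlinarith
  -- With this scale the tail exponent `dτ²/8` is `9√d/8 ≥ √d`, while `η₀² τ` is still small because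
  -- `d^(1/4)` is at least the square of a quadratic in `η₀`.
  set τ : ℝ := 3 / √√(d : ℝ) with hτ
  have hτ0 : 0 ≤ τ := by positivity
  obtain ⟨hsqrt, hητ, hηητ⟩ := AttnSelect.step_mul_tolerance_le hη16 hd3 hτ
  have hητ0 : 0 ≤ η₀ * τ := mul_nonneg (by linarith) hτ0
  refine ⟨{ω | AttnSelect.NearOrthogonal τ v ω.1 ω.2},
    AttnSelect.measurableSet_nearOrthogonal τ v, ?_, fun E₀ p₀ hG => ?_⟩
  · have h1 := AttnSelect.initLaw_compl_nearOrthogonal_le (S := S) hd0 hv hτ0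
    have h2 := h1.trans (ENNReal.ofReal_le_ofReal
      (AttnSelect.failure_probability_le hcard1 hδ hτ hsqrt hd2 hd4))
    rw [ENNReal.ofReal_sub _ hδ.le, ENNReal.ofReal_one, tsub_le_iff_right,
      ← prob_add_prob_compl (μ := AttnSelect.initLaw S d)
        (AttnSelect.measurableSet_nearOrthogonal (S := S) τ v)]
    gcongr
  · have hno : AttnSelect.NearOrthogonal τ v E₀ p₀ := hG
    obtain ⟨u, hu⟩ := hno.exists_separator hn hT0 hy hη16 hητ
      ((mul_le_mul_of_nonneg_right hcardη hητ0).trans hηητ) himp hirr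
    refine ⟨AttnSelect.existsUnique_isImportantMaxMargin
      ⟨u, (AttnSelect.mem_importantMarginSet_iff hy himp hirr).2 hu⟩, ?_⟩
    intro phat hphat p hp pinf hpinf _
    refine AttnSelect.eq_direction_and_not_isIrrelevant hn hT hy himp hirr (fun k j hj => ?_)
      (hno.loss_step_le hn hT0 hy hv hη16 hητ hη himp hirr) hp hphat hpinf
    have h1 := hno.abs_inner_stepE_v_sub_le (X := X) (y := y) hn hT0 hy hv hη16
      (by nlinarith) (X k j)
    rw [show AttnSelect.signedFreq X y (X k j) = 0 from hirr k j hj, zero_div, mul_zero,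
      sub_zero] at h1
    linarith
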